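/- Let $M$ be a lattice of finite rank with dual lattice $N$, let $\Sigma$ be a complete fan in $N_{\mathbb R}=N\otimes\mathbb R$ (a finite collection of strongly convex rational polyhedral cones, closed under taking faces, any two of which meet in a face of each, and whose union is $N_{\mathbb R}$), and let $X=X(\Sigma)$ be the associated toric variety over $\mathbb Z$, glued from the affine schemes $U_\sigma=\operatorname{Spec}\mathbb Z[\sigma^\vee\cap M]$. Let $q\ge 2$ be an integer, and let $F:X\to X$ be the endomorphism induced by multiplication by $q$ on $N$, given by $x^u\mapsto x^{qu}$ on each $U_\sigma$. Write $F$ also for the endomorphism $F\times F$ of $X\times X=X\times_{\operatorname{Spec}\mathbb Z}X$. A splitting of $X\times X$ is a map of $\mathcal O_{X\times X}$-modules $\pi:F_*\mathcal O_{X\times X}\to\mathcal O_{X\times X}$ such that $\pi\circ F^*$ is the identity on $\mathcal O_{X\times X}$, where $F^*:\mathcal O_{X\times X}\to F_*\mathcal O_{X\times X}$ is pullback of functions. It is compatible with the diagonal $\Delta\subset X\times X$ if $\pi(F_*I_\Delta)\subseteq I_\Delta$, where $I_\Delta$ is the ideal sheaf of $\Delta$. For a ray (one-dimensional cone) $\rho$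 of $\Sigma$ let $v_\rho\in N$ be its primitive generator, let $$\mathbb F_X=\{u\in M_{\mathbb R}\;:\;-1\le\langle u,v_\rho\rangle\le 1\text{ for all rays }\rho\in\Sigma\},$$ and let $\frac1qM=\{u\in M_{\mathbb R}: qu\in M\}$. Then $X\times X$ has a splitting compatible with the diagonal if and only if the interior of $\mathbb F_X$ contains a representative of every class in $\frac1qM/M$. -/

import Mathlib

open AlgebraicGeometry CategoryTheory CategoryTheory.Limits

noncomputable section

namespace Toric

/-! ### Lattices, cones and fans

The lattices `M` and `N` are both `ℤⁿ`, in dual bases: the pairing of `u ∈ M_ℝ = ℝⁿ` and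
`v ∈ N_ℝ = ℝⁿ` is the dot product `u ⬝ᵥ v`. -/

/-- The inclusion of the lattice `ℤⁿ` in `ℝⁿ`. -/
def incl (n : ℕ) : (Fin n → ℤ) →+ (Fin n → ℝ) where
  toFun v i := (v i : ℝ)
  map_zero' := by ext; simp
  map_add' _ _ := by ext; simp

/-- A rational polyhedral cone: one spanned by finitely many lattice points. -/
def IsRational {n : ℕ} (σ : PointedCone ℝ (Fin n → ℝ)) : Prop :=
  ∃ s : Set (Fin n → ℤ), s.Finite ∧ σ = PointedCone.hull ℝ (incl n '' s)

/-- The semigroup `σ^∨ ∩ M` of lattice points of `M` that are nonnegative on `σ`. -/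
def dualMonoid {n : ℕ} (σ : PointedCone ℝ (Fin n → ℝ)) : AddSubmonoid (Fin n → ℤ) where
  carrier := {u | ∀ v ∈ σ, 0 ≤ incl n u ⬝ᵥ v}
  zero_mem' v _ := by simp
  add_mem' {a b} ha hb v hv := by
    rw [map_add, add_dotProduct]
    exact add_nonneg (ha v hv) (hb v hv)

/-- `τ` is a face of the rational polyhedral cone `σ`: it is `σ ∩ u^⊥` for some `u` in
`σ^∨ ∩ M`. -/
def IsFace {n : ℕ} (τ σ : PointedCone ℝ (Fin n → ℝ)) : Prop :=
  ∃ u ∈ dualMonoid σ, ∀ v, v ∈ τ ↔ v ∈ σ ∧ incl n u ⬝ᵥ v = 0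

/-- A fan in `N_ℝ = ℝⁿ`: a finite set of strongly convex rational polyhedral cones that contains
every face of each of its cones, any two of which meet in a face of each. -/
structure Fan (n : ℕ) where
  cones : Set (PointedCone ℝ (Fin n → ℝ))
  finite : cones.Finite
  rational : ∀ σ ∈ cones, IsRational σ
  stronglyConvex : ∀ σ ∈ cones, (σ : ConvexCone ℝ (Fin n → ℝ)).Salient
  face_mem : ∀ σ ∈ cones, ∀ τ, IsFace τ σ → τ ∈ cones
  inf_isFace : ∀ σ ∈ cones, ∀ τ ∈ cones, IsFace (σ ⊓ τ) σ ∧ IsFace (σ ⊓ τ) τ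

/-- A fan is complete if its cones cover `N_ℝ`. -/
def Fan.IsComplete {n : ℕ} (Φ : Fan n) : Prop :=
  ∀ v : Fin n → ℝ, ∃ σ ∈ Φ.cones, v ∈ σ

/-- A lattice point is primitive if it is a multiple of another one only up to sign; in
particular it is nonzero. -/
def IsPrimitive {n : ℕ} (v : Fin n → ℤ) : Prop :=
  ∀ (k : ℤ) (w : Fin n → ℤ), v = k • w → IsUnit k

/-- The primitive generators `v_ρ` of the rays `ρ` (the one-dimensional cones) of a fan. -/
def Fan.rayGenerators {n : ℕ} (Φ : Fan n) : Set (Fin n → ℤ) :=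
  {v | IsPrimitive v ∧ PointedCone.hull ℝ {incl n v} ∈ Φ.cones}

/-- The diagonal splitting polytope `{u ∈ M_ℝ | -1 ≤ ⟨u, v_ρ⟩ ≤ 1 for all rays ρ}`. -/
def Fan.diagonalSplittingPolytope {n : ℕ} (Φ : Fan n) : Set (Fin n → ℝ) :=
  {u | ∀ v ∈ Φ.rayGenerators, -1 ≤ u ⬝ᵥ incl n v ∧ u ⬝ᵥ incl n v ≤ 1}

/-- The lattice `M`, as a subgroup of `M_ℝ`. -/
def latticeM (n : ℕ) : AddSubgroup (Fin n → ℝ) := (incl n).range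

/-- The group `(1/q)M` of fractional lattice points: the `u ∈ M_ℝ` with `q u ∈ M`. -/
def fractionalM (n q : ℕ) : AddSubgroup (Fin n → ℝ) :=
  (latticeM n).comap (nsmulAddMonoidHom q)

/-! ### The affine charts -/

/-- The ring map `ℤ[σ^∨ ∩ M] → ℤ[τ^∨ ∩ M]` for cones `τ ⊆ σ`. -/
def restrictionMap {n : ℕ} {τ σ : PointedCone ℝ (Fin n → ℝ)} (h : τ ≤ σ) :
    AddMonoidAlgebra ℤ (dualMonoid σ) →+* AddMonoidAlgebra ℤ (dualMonoid τ) :=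
  AddMonoidAlgebra.mapDomainRingHom ℤ
    (AddSubmonoid.inclusion (T := dualMonoid τ) fun _ hu v hv ↦ hu v (h hv))

lemma restrictionMap_comp {n : ℕ} {ρ τ σ : PointedCone ℝ (Fin n → ℝ)} (h : ρ ≤ τ) (h' : τ ≤ σ) :
    (restrictionMap h).comp (restrictionMap h') = restrictionMap (h.trans h') := by
  rw [restrictionMap, restrictionMap, ← AddMonoidAlgebra.mapDomainRingHom_comp]
  rfl

lemma exists_add_nsmul_mem {n : ℕ} {τ σ : PointedCone ℝ (Fin n → ℝ)} (hσ : IsRational σ)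
    {u : Fin n → ℤ} (hu : u ∈ dualMonoid σ)
    (hτ : ∀ v, v ∈ τ ↔ v ∈ σ ∧ incl n u ⬝ᵥ v = 0) {w : Fin n → ℤ} (hw : w ∈ dualMonoid τ) :
    ∃ k : ℕ, w + k • u ∈ dualMonoid σ := by
  obtain ⟨s, hs, rfl⟩ := hσ
  have key : ∀ v ∈ s, ∃ k : ℕ, ∀ m ≥ k,
      0 ≤ incl n (w + m • u) ⬝ᵥ incl n v := by
    intro v hv
    have hmem : incl n v ∈ PointedCone.hull ℝ (incl n '' s) :=
      PointedCone.subset_hull ⟨v, hv, rfl⟩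
    by_cases h0 : incl n u ⬝ᵥ incl n v = 0
    · refine ⟨0, fun m _ ↦ ?_⟩
      rw [map_add, map_nsmul, add_dotProduct, smul_dotProduct, h0, smul_zero, add_zero]
      exact hw _ ((hτ _).2 ⟨hmem, h0⟩)
    · have hpos : 0 < incl n u ⬝ᵥ incl n v := lt_of_le_of_ne (hu _ hmem) (Ne.symm h0)
      obtain ⟨k, hk⟩ := exists_nat_ge (-(incl n w ⬝ᵥ incl n v) / (incl n u ⬝ᵥ incl n v))
      refine ⟨k, fun m hm ↦ ?_⟩
      rw [map_add, map_nsmul, add_dotProduct, smul_dotProduct, nsmul_eq_mul]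
      rw [div_le_iff₀ hpos] at hk
      have : (k : ℝ) * (incl n u ⬝ᵥ incl n v) ≤ m * (incl n u ⬝ᵥ incl n v) := by
        gcongr
      linarith
  choose! k hk using key
  refine ⟨hs.toFinset.sup k, fun v hv ↦ ?_⟩
  induction hv using Submodule.span_induction with
  | mem x hx =>
    obtain ⟨v, hv, rfl⟩ := hx
    exact hk v hv _ (Finset.le_sup (hs.mem_toFinset.2 hv))
  | zero => simp
  | add x y _ _ hx hy => rw [dotProduct_add]; exact add_nonneg hx hy
  | smul a x _ hx =>
    have : a • x = (a : ℝ) • x := rfl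
    rw [this, dotProduct_smul]
    exact smul_nonneg a.2 hx

lemma neg_mem_dualMonoid {n : ℕ} {τ σ : PointedCone ℝ (Fin n → ℝ)} {u : Fin n → ℤ}
    (hτ : ∀ v, v ∈ τ ↔ v ∈ σ ∧ incl n u ⬝ᵥ v = 0) : -u ∈ dualMonoid τ := by
  intro v hv
  rw [map_neg, neg_dotProduct, ((hτ v).1 hv).2, neg_zero]

lemma restrictionMap_single {n : ℕ} {τ σ : PointedCone ℝ (Fin n → ℝ)} (h : τ ≤ σ)
    (u : dualMonoid σ) (r : ℤ) :
    restrictionMap h (.single u r) = .single ⟨u, fun v hv ↦ u.2 v (h hv)⟩ r := by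
  simp [restrictionMap]
  rfl

lemma restrictionMap_injective {n : ℕ} {τ σ : PointedCone ℝ (Fin n → ℝ)} (h : τ ≤ σ) :
    Function.Injective (restrictionMap h) :=
  AddMonoidAlgebra.mapDomain_injective (AddSubmonoid.inclusion_injective _)

lemma restrictionMap_isLocalization {n : ℕ} {τ σ : PointedCone ℝ (Fin n → ℝ)} (h : τ ≤ σ)
    (hσ : IsRational σ) {u : Fin n → ℤ} (hu : u ∈ dualMonoid σ)
    (hτ : ∀ v, v ∈ τ ↔ v ∈ σ ∧ incl n u ⬝ᵥ v = 0) :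
    let := (restrictionMap h).toAlgebra
    IsLocalization.Away (AddMonoidAlgebra.single (⟨u, hu⟩ : dualMonoid σ) (1 : ℤ))
      (AddMonoidAlgebra ℤ (dualMonoid τ)) := by
  let := (restrictionMap h).toAlgebra
  have halg : ∀ x, algebraMap (AddMonoidAlgebra ℤ (dualMonoid σ))
      (AddMonoidAlgebra ℤ (dualMonoid τ)) x = restrictionMap h x := fun _ ↦ rfl
  refine IsLocalization.Away.mk (S := AddMonoidAlgebra ℤ (dualMonoid τ)) _ ?_ ?_ ?_
  · rw [halg, restrictionMap_single]
    refine IsUnit.of_mul_eq_one (.single ⟨-u, neg_mem_dualMonoid hτ⟩ 1) ?_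
    rw [AddMonoidAlgebra.single_mul_single, AddMonoidAlgebra.one_def]
    congr 1
    exact Subtype.ext (add_neg_cancel u)
  · intro x
    induction x using AddMonoidAlgebra.induction_linear with
    | zero => exact ⟨0, 0, by simp⟩
    | add x y hx hy =>
      obtain ⟨k, a, ha⟩ := hx
      obtain ⟨l, b, hb⟩ := hy
      refine ⟨k + l, a * .single ⟨u, hu⟩ 1 ^ l + b * .single ⟨u, hu⟩ 1 ^ k, ?_⟩
      rw [map_add, map_mul, map_mul, ← ha, ← hb, map_pow, map_pow]
      ring
    | single w r =>
      obtain ⟨k, hk⟩ := exists_add_nsmul_mem hσ hu hτ w.2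
      refine ⟨k, .single ⟨_, hk⟩ r, ?_⟩
      rw [halg, halg, restrictionMap_single, restrictionMap_single, AddMonoidAlgebra.single_pow,
        AddMonoidAlgebra.single_mul_single, one_pow, mul_one]
      rfl
  · intro a b hab
    exact ⟨0, by rw [restrictionMap_injective h hab]⟩

/-- The charts of the fan: its cones, ordered by inclusion. -/
abbrev Fan.Index {n : ℕ} (Φ : Fan n) : Type := {σ // σ ∈ Φ.cones}

/-- The diagram of the affine toric varieties `U_σ = Spec ℤ[σ^∨ ∩ M]`, for `σ` in the fan, and
of the inclusions `U_τ → U_σ` for the faces `τ` of `σ`. -/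
def Fan.diagram {n : ℕ} (Φ : Fan n) : Φ.Index ⥤ Scheme.{0} where
  obj σ := Spec (.of (AddMonoidAlgebra ℤ (dualMonoid σ.1)))
  map {τ σ} f := Spec.map (CommRingCat.ofHom (restrictionMap (leOfHom f)))
  map_id σ := by
    rw [← Spec.map_id]
    congr 1
    exact CommRingCat.hom_ext (AddMonoidAlgebra.mapDomainRingHom_id ..)
  map_comp f g := by
    rw [← Spec.map_comp]
    congr 1
    rw [← CommRingCat.ofHom_comp]
    exact congrArg CommRingCat.ofHom (restrictionMap_comp (leOfHom f) (leOfHom g)).symm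

lemma Fan.isFace_of_le {n : ℕ} (Φ : Fan n) {τ σ : Φ.Index} (h : τ ≤ σ) : IsFace τ.1 σ.1 := by
  have := (Φ.inf_isFace _ σ.2 _ τ.2).1
  rwa [inf_eq_right.2 (show τ.1 ≤ σ.1 from h)] at this

lemma IsFace.isOpenImmersion {n : ℕ} {τ σ : PointedCone ℝ (Fin n → ℝ)} (hσ : IsRational σ)
    (hτ : IsFace τ σ) (h : τ ≤ σ) :
    IsOpenImmersion (Spec.map (CommRingCat.ofHom (restrictionMap h))) := by
  obtain ⟨u, hu, hτ⟩ := hτ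
  let := (restrictionMap h).toAlgebra
  have := restrictionMap_isLocalization h hσ hu hτ
  exact IsOpenImmersion.of_isLocalization
    (AddMonoidAlgebra.single (⟨u, hu⟩ : dualMonoid σ) (1 : ℤ))

lemma range_comap_restrictionMap {n : ℕ} {τ σ : PointedCone ℝ (Fin n → ℝ)} (hσ : IsRational σ)
    {u : Fin n → ℤ} (hu : u ∈ dualMonoid σ) (hτ : ∀ v, v ∈ τ ↔ v ∈ σ ∧ incl n u ⬝ᵥ v = 0)
    (h : τ ≤ σ) :
    Set.range (PrimeSpectrum.comap (restrictionMap h)) =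
      (PrimeSpectrum.basicOpen (AddMonoidAlgebra.single (⟨u, hu⟩ : dualMonoid σ) (1 : ℤ)) :
        Set (PrimeSpectrum (AddMonoidAlgebra ℤ (dualMonoid σ)))) := by
  let := (restrictionMap h).toAlgebra
  have := restrictionMap_isLocalization h hσ hu hτ
  exact PrimeSpectrum.localization_away_comap_range _ _

instance {n : ℕ} (Φ : Fan n) {τ σ : Φ.Index} (f : τ ⟶ σ) :
    IsOpenImmersion (Φ.diagram.map f) :=
  (Φ.isFace_of_le (leOfHom f)).isOpenImmersion (Φ.rational _ σ.2) (leOfHom f)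

instance {n : ℕ} (Φ : Fan n) : (Φ.diagram ⋙ Scheme.forget).IsLocallyDirected where
  cond {τ₁ τ₂ σ} f₁ f₂ x₁ x₂ hx := by
    obtain ⟨u₁, hu₁, h₁⟩ := Φ.isFace_of_le (leOfHom f₁)
    obtain ⟨u₂, hu₂, h₂⟩ := Φ.isFace_of_le (leOfHom f₂)
    let ρ : Φ.Index := ⟨τ₁.1 ⊓ τ₂.1,
      Φ.face_mem _ τ₁.2 _ (Φ.inf_isFace _ τ₁.2 _ τ₂.2).1⟩
    let g₁ : ρ ⟶ τ₁ := homOfLE (show ρ.1 ≤ τ₁.1 from inf_le_left)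
    let g₂ : ρ ⟶ τ₂ := homOfLE (show ρ.1 ≤ τ₂.1 from inf_le_right)
    have hρ : ∀ v, v ∈ ρ.1 ↔ v ∈ σ.1 ∧ incl n (u₁ + u₂) ⬝ᵥ v = 0 := by
      intro v
      rw [Submodule.mem_inf, h₁, h₂, map_add, add_dotProduct]
      constructor
      · rintro ⟨⟨hv, h1⟩, -, h2⟩
        exact ⟨hv, by rw [h1, h2, add_zero]⟩
      · rintro ⟨hv, h12⟩
        have h1 := hu₁ v hv
        have h2 := hu₂ v hv
        exact ⟨⟨hv, by linarith⟩, hv, by linarith⟩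
    let p : PrimeSpectrum (AddMonoidAlgebra ℤ (dualMonoid σ.1)) := Φ.diagram.map f₁ x₁
    have hp₁ : p ∈ PrimeSpectrum.basicOpen
        (AddMonoidAlgebra.single (⟨u₁, hu₁⟩ : dualMonoid σ.1) (1 : ℤ)) := by
      have := range_comap_restrictionMap (Φ.rational _ σ.2) hu₁ h₁ (leOfHom f₁)
      exact (Set.ext_iff.1 this p).1 ⟨x₁, rfl⟩
    have hp₂ : p ∈ PrimeSpectrum.basicOpen
        (AddMonoidAlgebra.single (⟨u₂, hu₂⟩ : dualMonoid σ.1) (1 : ℤ)) := by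
      have := range_comap_restrictionMap (Φ.rational _ σ.2) hu₂ h₂ (leOfHom f₂)
      exact (Set.ext_iff.1 this p).1 ⟨x₂, hx.symm⟩
    have hp : p ∈ PrimeSpectrum.basicOpen
        (AddMonoidAlgebra.single (⟨u₁ + u₂, add_mem hu₁ hu₂⟩ : dualMonoid σ.1) (1 : ℤ)) := by
      have : (AddMonoidAlgebra.single (⟨u₁ + u₂, add_mem hu₁ hu₂⟩ : dualMonoid σ.1) (1 : ℤ)) =
          .single ⟨u₁, hu₁⟩ 1 * .single ⟨u₂, hu₂⟩ 1 := by
        rw [AddMonoidAlgebra.single_mul_single, one_mul]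
        rfl
      rw [this, PrimeSpectrum.basicOpen_mul]
      exact ⟨hp₁, hp₂⟩
    have hσρ := range_comap_restrictionMap (Φ.rational _ σ.2) (add_mem hu₁ hu₂) hρ
      (leOfHom (g₁ ≫ f₁))
    obtain ⟨(x : Φ.diagram.obj ρ), hx'⟩ := (Set.ext_iff.1 hσρ p).2 hp
    replace hx' : Φ.diagram.map (g₁ ≫ f₁) x = Φ.diagram.map f₁ x₁ := hx'
    have hx₁ : Φ.diagram.map f₁ (Φ.diagram.map g₁ x) = Φ.diagram.map f₁ x₁ := by
      rw [← hx', ← Scheme.Hom.comp_apply, ← Functor.map_comp]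
    have hx₂ : Φ.diagram.map f₂ (Φ.diagram.map g₂ x) = Φ.diagram.map f₂ x₂ := by
      refine Eq.trans ?_ (hx₁.trans hx)
      rw [← Scheme.Hom.comp_apply, ← Scheme.Hom.comp_apply, ← Functor.map_comp,
        ← Functor.map_comp]
      rfl
    exact ⟨ρ, g₁, g₂, x, (Φ.diagram.map f₁).isOpenEmbedding.injective hx₁,
      (Φ.diagram.map f₂).isOpenEmbedding.injective hx₂⟩

/-- The toric variety `X(Φ)` over `ℤ`: the charts `U_σ` glued along the `U_τ`, `τ` a face. -/
def Fan.toricVariety {n : ℕ} (Φ : Fan n) : Scheme.{0} := colimit Φ.diagram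

/-- The endomorphism `x^u ↦ x^{qu}` of `ℤ[σ^∨ ∩ M]`. -/
def chartFrobenius {n : ℕ} (q : ℕ) (σ : PointedCone ℝ (Fin n → ℝ)) :
    AddMonoidAlgebra ℤ (dualMonoid σ) →+* AddMonoidAlgebra ℤ (dualMonoid σ) :=
  AddMonoidAlgebra.mapDomainRingHom ℤ (nsmulAddMonoidHom q)

lemma chartFrobenius_comp_restrictionMap {n : ℕ} (q : ℕ) {τ σ : PointedCone ℝ (Fin n → ℝ)}
    (h : τ ≤ σ) : (chartFrobenius q τ).comp (restrictionMap h) =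
      (restrictionMap h).comp (chartFrobenius q σ) := by
  rw [chartFrobenius, chartFrobenius, restrictionMap, ← AddMonoidAlgebra.mapDomainRingHom_comp,
    ← AddMonoidAlgebra.mapDomainRingHom_comp]
  rfl

/-- The lifted Frobenius `F : X → X`, induced by multiplication by `q` on `N`: on each chart it
is `x^u ↦ x^{qu}`. -/
def Fan.frobenius {n : ℕ} (Φ : Fan n) (q : ℕ) : Φ.toricVariety ⟶ Φ.toricVariety :=
  colimMap
    { app := fun σ ↦ Spec.map (CommRingCat.ofHom (chartFrobenius q σ.1))
      naturality := fun τ σ f ↦ by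
        dsimp only [Fan.diagram]
        rw [← Spec.map_comp, ← Spec.map_comp, ← CommRingCat.ofHom_comp, ← CommRingCat.ofHom_comp,
          chartFrobenius_comp_restrictionMap] }

/-! ### Splittings -/

/-- The structure sheaf `𝒪_X` as a module over itself. -/
def structureModule (X : Scheme.{0}) : X.Modules := SheafOfModules.unit X.ringCatSheaf

/-- Pulling back functions, `F^* : 𝒪_X → F_* 𝒪_X`, as a map of `𝒪_X`-modules. -/
def pullbackFunctions {X : Scheme.{0}} (F : X ⟶ X) :
    structureModule X ⟶ (Scheme.Modules.pushforward F).obj (structureModule X) :=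
  SheafOfModules.unitToPushforwardObjUnit F.toRingCatSheafHom

/-- A splitting of `X` with respect to `F : X → X`: a map of `𝒪_X`-modules
`π : F_* 𝒪_X → 𝒪_X` such that `π ∘ F^*` is the identity. -/
structure Splitting {X : Scheme.{0}} (F : X ⟶ X) where
  hom : (Scheme.Modules.pushforward F).obj (structureModule X) ⟶ structureModule X
  comp_hom : pullbackFunctions F ≫ hom = 𝟙 (structureModule X)

/-- The map on sections `Γ(X, F⁻¹ U) → Γ(X, U)` of a splitting. -/
def Splitting.app {X : Scheme.{0}} {F : X ⟶ X} (π : Splitting F) (U : X.Opens) :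
    Γ(X, F ⁻¹ᵁ U) →+ Γ(X, U) := (π.hom.app U).hom

/-- The ideal of sections over `U` of the ideal sheaf `I_Y` of a subscheme `i : Y → X`: the
functions on `U` that vanish on `Y`. -/
def idealOf {Y X : Scheme.{0}} (i : Y ⟶ X) (U : X.Opens) : Ideal Γ(X, U) :=
  RingHom.ker (i.app U).hom

/-- A splitting `π` is compatible with the subscheme `i : Y → X` if `π (F_* I_Y) ⊆ I_Y`. -/
def Splitting.IsCompatibleWith {X Y : Scheme.{0}} {F : X ⟶ X} (π : Splitting F) (i : Y ⟶ X) :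
    Prop :=
  ∀ (U : X.Opens) (s : Γ(X, F ⁻¹ᵁ U)), s ∈ idealOf i (F ⁻¹ᵁ U) → π.app U s ∈ idealOf i U

/-- The variety `X` of the fan is diagonally split (for `q`): some splitting of `X × X`, with
respect to the lifted Frobenius `F × F`, is compatible with the diagonal. The product is over
`Spec ℤ`, the terminal scheme. -/
def Fan.IsDiagonallySplit {n : ℕ} (Φ : Fan n) (q : ℕ) : Prop :=
  ∃ π : Splitting (prod.map (Φ.frobenius q) (Φ.frobenius q)),
    π.IsCompatibleWith (diag Φ.toricVariety)

end Toric

end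

noncomputable section

namespace Toric

/-! The zero cone gives the torus T, and the functions on each chart U_σ × U_τ embed in the Laurent
ring ℤ[M × M]. Every such chart is its own preimage under F × F. A splitting of X × X is therefore
an additive map p on ℤ[M × M] with p(x^(qm) f) = x^m p(f) and p(1) = 1 that preserves the subring of
every chart. Compatibility with the diagonal can be tested on the torus, where it says that p
preserves the kernel of x^(u,w) ↦ x^(u+w). This reduction is `Fan.isDiagonallySplit_iff`;
`exists_splitting` extends p from the torus to X × X, and `Splitting.isCompatibleWith_of_dense`
extends the compatibility.

The condition on classes says that every u in M has a w in M with |q⟨w,v⟩ - ⟨u,v⟩| < q for all ray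
generators v, that is, w - u/q is interior to the polytope (`Fan.forall_exists_representative_iff`).

Necessity: x^(u,-u) - 1 vanishes on the diagonal, so p(x^(u,-u)) restricts to 1 there and contains
some monomial x^(w,-w). Since p preserves the functions on U_ρ × T and on T × U_ρ, this w satisfies
the lower and the upper bound along ρ.

Sufficiency: choose the w's as a function e with e(qm + u) = m + e(u) and e(0) = 0, and let p send
x^(u,w) to x^(e(u), (u+w)/q - e(u)) if u + w is in qM, and to 0 otherwise. On the diagonal this
induces x^y ↦ x^(y/q) or 0, so p is compatible. By integrality the strict bounds keep both exponents
nonnegative on the rays of a cone where u and w are; as the cones are spanned by their rays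
(`Fan.mem_dualMonoid_of_rays`, through Gordan's theorem), p preserves every chart. -/

/-! ### Semilinear maps and localization -/

/-- An additive map `p : B → A` is inverse-semilinear along `φ : A → B` if it is a map of
`A`-modules from `B`, viewed as an `A`-module through `φ`, to `A`. -/
def IsSemilinear {A B : Type*} [CommRing A] [CommRing B] (φ : A →+* B) (p : B →+ A) : Prop :=
  ∀ a b, p (φ a * b) = a * p b

/-- `α : A → A'` has the two properties of the localization at the powers of `g` that concern
the elements: every element of `A'` is a fraction, and the kernel is torsion. -/
structure IsFraction {A A' : Type*} [CommRing A] [CommRing A'] (α : A →+* A') (g : A) : Prop where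
  isUnit : IsUnit (α g)
  surj : ∀ s, ∃ (k : ℕ) (h : A), α h = α g ^ k * s
  torsion : ∀ h, α h = 0 → ∃ m : ℕ, g ^ m * h = 0

lemma exists_localized_map {A B A' B' : Type*} [CommRing A] [CommRing B] [CommRing A'] [CommRing B']
    (φ : A →+* B) (φ' : A' →+* B') (α : A →+* A') (β : B →+* B')
    (hcomm : ∀ a, φ' (α a) = β (φ a)) (g : A) (hα : IsFraction α g) (hβ : IsFraction β (φ g))
    (p : B →+ A) (hp : IsSemilinear φ p) :
    ∃ p' : B' →+ A', (∀ h, p' (β h) = α (p h)) ∧ IsSemilinear φ' p' := by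
  choose k h hk using hβ.surj
  obtain ⟨u, hu⟩ := hα.isUnit
  have hpow (m : ℕ) (b : B) : p (φ g ^ m * b) = g ^ m * p b := by rw [← map_pow, hp]
  have hcancel {m : ℕ} {a b : A'} (hab : α g ^ m * a = α g ^ m * b) : a = b :=
    (hα.isUnit.pow m).mul_left_cancel hab
  let f : B' → A' := fun s ↦ ↑(u⁻¹ ^ k s) * α (p (h s))
  have hf (s : B') : α g ^ k s * f s = α (p (h s)) := by
    simp only [f, ← hu, ← mul_assoc, ← Units.val_pow_eq_pow_val, ← Units.val_mul]
    simp
  -- The value `f s` does not depend on the fraction chosen for `s`: two numerators agree up to a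
  -- power of `φ g`, and `p` turns that power into a power of `g`, a unit in `A'`.
  have key (s : B') (m : ℕ) (b : B) (hb : β b = β (φ g) ^ m * s) : α g ^ m * f s = α (p b) := by
    have h0 : β (φ g ^ m * h s - φ g ^ k s * b) = 0 := by
      rw [map_sub, map_mul, map_mul, map_pow, map_pow, hb, hk]; ring
    obtain ⟨l, hl⟩ := hβ.torsion _ h0
    have h1 := congrArg (fun b ↦ α (p b)) hl
    simp only [hpow, map_sub, map_zero, map_mul, map_pow] at h1
    apply hcancel (m := k s)
    apply hcancel (m := l)
    rw [mul_left_comm (α g ^ k s), hf]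
    linear_combination h1
  have huniq (s : B') (m : ℕ) (b : B) (t : A') (hb : β b = β (φ g) ^ m * s)
      (ht : α g ^ m * t = α (p b)) : f s = t := hcancel ((key s m b hb).trans ht.symm)
  refine ⟨⟨⟨f, ?_⟩, ?_⟩, ?_, ?_⟩
  · exact huniq 0 0 0 0 (by simp) (by simp)
  · intro s s'
    refine huniq _ (k s + k s') (φ g ^ k s' * h s + φ g ^ k s * h s') _ ?_ ?_
    · rw [map_add, map_mul, map_mul, map_pow, map_pow, hk, hk]; ring
    · rw [map_add, map_add, hpow, hpow, map_mul, map_mul, map_pow, map_pow, ← hf s, ← hf s']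
      dsimp; ring
  · intro b
    exact huniq _ 0 b _ (by simp) (by simp)
  · intro a s
    obtain ⟨l, a', ha⟩ := hα.surj a
    refine huniq _ (l + k s) (φ a' * h s) _ ?_ ?_
    · rw [map_mul, ← hcomm, ha, hk, map_mul, map_pow, hcomm]; ring
    · rw [hp, map_mul, ha, ← hf s]; dsimp; ring

/-! ### Sections of schemes -/

/-- Restriction of functions. -/
def res {X : Scheme.{0}} {U V : X.Opens} (h : V ≤ U) : Γ(X, U) →+* Γ(X, V) :=
  (X.presheaf.map (homOfLE h).op).hom

/-- Pullback of functions along `f`, to an open subset of the preimage. -/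
def pull {X Y : Scheme.{0}} (f : X ⟶ Y) {U : Y.Opens} {V : X.Opens} (h : V ≤ f ⁻¹ᵁ U) :
    Γ(Y, U) →+* Γ(X, V) :=
  (f.appLE U V h).hom

section

variable {X Y Z : Scheme.{0}}

@[simp] lemma res_res {U V W : X.Opens} (h : V ≤ U) (h' : W ≤ V) (s : Γ(X, U)) :
    res h' (res h s) = res (h'.trans h) s := by
  simp only [res, ← CommRingCat.comp_apply, ← Functor.map_comp]
  rfl

@[simp] lemma res_pull (f : X ⟶ Y) {U : Y.Opens} {V W : X.Opens} (h : V ≤ f ⁻¹ᵁ U) (h' : W ≤ V)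
    (s : Γ(Y, U)) : res h' (pull f h s) = pull f (h'.trans h) s := by
  simp only [res, pull, ← CommRingCat.comp_apply, Scheme.Hom.appLE_map]

@[simp] lemma pull_res (f : X ⟶ Y) {U U' : Y.Opens} {V : X.Opens} (h : V ≤ f ⁻¹ᵁ U') (h' : U' ≤ U)
    (s : Γ(Y, U)) : pull f h (res h' s) = pull f (h.trans (f.preimage_mono h')) s := by
  simp only [res, pull, ← CommRingCat.comp_apply, Scheme.Hom.map_appLE]

lemma pull_pull (f : X ⟶ Y) (g : Y ⟶ Z) {U : Z.Opens} {V : Y.Opens} {W : X.Opens}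
    (h : V ≤ g ⁻¹ᵁ U) (h' : W ≤ f ⁻¹ᵁ V) (s : Γ(Z, U)) :
    pull f h' (pull g h s) = pull (f ≫ g) (h'.trans (f.preimage_mono h)) s := by
  simp only [pull, ← CommRingCat.comp_apply, Scheme.Hom.appLE_comp_appLE]

lemma app_eq_pull (f : X ⟶ Y) (U : Y.Opens) (s : Γ(Y, U)) :
    (f.app U).hom s = pull f (le_refl _) s := by
  simp only [pull, Scheme.Hom.appLE_eq_app]

lemma eq_of_locally_eq {U : X.Opens} (s t : Γ(X, U))
    (h : ∀ x ∈ U, ∃ (V : X.Opens) (hV : V ≤ U), x ∈ V ∧ res hV s = res hV t) : s = t := by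
  choose! V hV hx hst using h
  refine X.sheaf.eq_of_locally_eq' (fun x : U ↦ V x) U (fun x ↦ homOfLE (hV x x.2)) ?_ s t
    fun x ↦ hst x x.2
  intro x hxU
  exact TopologicalSpace.Opens.mem_iSup.2 ⟨⟨x, hxU⟩, hx x hxU⟩

lemma isFraction_res {U : X.Opens} (hU : IsAffineOpen U) (g : Γ(X, U)) {W : X.Opens}
    (hW : W = X.basicOpen g) (h : W ≤ U) : IsFraction (res h) g := by
  subst hW
  have := hU.isLocalization_basicOpen g
  have halg (x) : algebraMap Γ(X, U) Γ(X, X.basicOpen g) x = res h x := rfl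
  refine ⟨?_, fun s ↦ ?_, fun s hs ↦ ?_⟩
  · rw [← halg]; exact IsLocalization.Away.algebraMap_isUnit g
  · obtain ⟨k, a, ha⟩ := IsLocalization.Away.surj g s
    exact ⟨k, a, by rw [← halg, ← ha, halg, mul_comm]⟩
  · rw [← halg] at hs
    obtain ⟨⟨_, k, rfl⟩, hc⟩ := (IsLocalization.map_eq_zero_iff (Submonoid.powers g) _ s).1 hs
    exact ⟨k, hc⟩

lemma preimage_basicOpen_eq (f : X ⟶ Y) {U : Y.Opens} (g : Γ(Y, U)) :
    f ⁻¹ᵁ Y.basicOpen g = X.basicOpen (pull f (le_refl (f ⁻¹ᵁ U)) g) := by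
  rw [Scheme.preimage_basicOpen, ← app_eq_pull]

lemma basicOpen_res {U V : X.Opens} (h : V ≤ U) (g : Γ(X, U)) :
    X.basicOpen (res h g) = V ⊓ X.basicOpen g :=
  X.basicOpen_res g (homOfLE h).op

lemma basicOpen_pull (f : X ⟶ Y) {U : Y.Opens} {V : X.Opens} (h : V ≤ f ⁻¹ᵁ U) (g : Γ(Y, U)) :
    X.basicOpen (pull f h g) = V ⊓ f ⁻¹ᵁ Y.basicOpen g := by
  rw [preimage_basicOpen_eq, ← basicOpen_res h, res_pull]

/-- If `X` is covered by affine opens containing `V`, on each of which functions are determined by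
their restriction to `V`, then functions on any open `U` are determined by their restrictions to
the basic opens of `V` inside `U`. -/
lemma eq_zero_of_basicOpen {ι : Type*} {U : ι → X.Opens} (hU : ∀ i, IsAffineOpen (U i))
    (hcov : ∀ x, ∃ i, x ∈ U i) {V : X.Opens} (hV : IsAffineOpen V) (hVU : ∀ i, V ≤ U i)
    (hinj : ∀ i, Function.Injective (res (hVU i)))
    {W : X.Opens} (t : Γ(X, W))
    (ht : ∀ (g : Γ(X, V)) (h : X.basicOpen g ≤ W), res h t = 0) : t = 0 := by
  apply eq_of_locally_eq
  intro x hx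
  obtain ⟨i, hi⟩ := hcov x
  obtain ⟨f, hfW, hxf⟩ := (hU i).exists_basicOpen_le ⟨x, hx⟩ hi
  refine ⟨_, hfW, hxf, ?_⟩
  have hfr := isFraction_res (hU i) f rfl (X.basicOpen_le f)
  -- On `D(f)`, `t = a / f ^ k`. Inside `V`, `t` vanishes on `D(f)`, so a power of `f` kills `a` on
  -- `V`, and injectivity of restriction carries this equation back to `U i`.
  obtain ⟨k, a, ha⟩ := hfr.surj (res hfW t)
  have hle : X.basicOpen (res (hVU i) f) ≤ W := (basicOpen_res _ _).le.trans (inf_le_right.trans hfW)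
  have hle' : X.basicOpen (res (hVU i) f) ≤ X.basicOpen f := (basicOpen_res _ _).le.trans inf_le_right
  have h0 := ht (res (hVU i) f) hle
  have h1 := congrArg (res hle') ha
  simp only [map_mul, res_res, h0, mul_zero] at h1
  have hfrV := isFraction_res hV (res (hVU i) f) rfl (X.basicOpen_le _)
  obtain ⟨m, hm⟩ := hfrV.torsion (res (hVU i) a) (by rw [res_res, h1])
  rw [← map_pow, ← map_mul] at hm
  have hm' : f ^ m * a = 0 := hinj i (by rw [hm, map_zero])
  rw [map_zero]
  apply (hfr.isUnit.pow (m + k)).mul_left_cancel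
  rw [mul_zero, pow_add, mul_assoc, ← ha, ← map_pow, ← map_mul, hm', map_zero]

/-! ### Extending a semilinear map from a dense affine open -/

section

variable {F : Y ⟶ Y} {V : Y.Opens}

lemma preimage_basicOpen_le (F : Y ⟶ Y) (g : Γ(Y, V)) : F ⁻¹ᵁ Y.basicOpen g ≤ F ⁻¹ᵁ V :=
  F.preimage_mono (Y.basicOpen_le g)

variable (V) in
/-- The relation between functions `s` on `F⁻¹ U` and `t` on `U` that says that on each basic open
of `V` the functions correspond under the maps `P g`. -/
def Corresponds (P : ∀ g : Γ(Y, V), Γ(Y, F ⁻¹ᵁ Y.basicOpen g) →+ Γ(Y, Y.basicOpen g))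
    (U : Y.Opens) (s : Γ(Y, F ⁻¹ᵁ U)) (t : Γ(Y, U)) : Prop :=
  ∀ (g : Γ(Y, V)) (h : Y.basicOpen g ≤ U), P g (res (F.preimage_mono h) s) = res h t

/-- Since `F⁻¹ D(g) = D(F^* g)`, `p` localizes to every basic open of `V`. The localizations commute
with restriction because, after multiplication by a power of the unit `g`, both sides come from `p`
on `V`. -/
lemma exists_localized_maps (hV : IsAffineOpen V) (hFV : IsAffineOpen (F ⁻¹ᵁ V))
    (p : Γ(Y, F ⁻¹ᵁ V) →+ Γ(Y, V)) (hp : IsSemilinear (pull F le_rfl) p) :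
    ∃ P : ∀ g : Γ(Y, V), Γ(Y, F ⁻¹ᵁ Y.basicOpen g) →+ Γ(Y, Y.basicOpen g),
      (∀ g s, P g (res (preimage_basicOpen_le F g) s) = res (Y.basicOpen_le g) (p s)) ∧
      (∀ g, IsSemilinear (pull F le_rfl) (P g)) ∧
      ∀ (g g' : Γ(Y, V)) (h : Y.basicOpen g' ≤ Y.basicOpen g) s,
        P g' (res (F.preimage_mono h) s) = res h (P g s) := by
  have hα (g : Γ(Y, V)) := isFraction_res hV g rfl (Y.basicOpen_le g)
  have hβ (g : Γ(Y, V)) := isFraction_res hFV (pull F le_rfl g) (preimage_basicOpen_eq F g)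
    (preimage_basicOpen_le F g)
  choose P hP hPs using fun g ↦ exists_localized_map (pull F (le_refl (F ⁻¹ᵁ V)))
    (pull F (le_refl (F ⁻¹ᵁ Y.basicOpen g))) (res (Y.basicOpen_le g))
    (res (preimage_basicOpen_le F g)) (fun a ↦ by simp) g (hα g) (hβ g) p hp
  refine ⟨P, hP, hPs, fun g g' h s ↦ ?_⟩
  obtain ⟨k, b, hb⟩ := (hβ g).surj s
  have hu : IsUnit (res h (res (Y.basicOpen_le g) g)) := (hα g).isUnit.map _
  apply (hu.pow k).mul_left_cancel
  rw [← map_pow, ← map_pow, ← map_mul, ← hPs, ← hPs]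
  have h1 : pull F (le_refl _) (res (Y.basicOpen_le g) (g ^ k)) * s =
      res (preimage_basicOpen_le F g) b := by
    rw [hb]; simp
  have h2 : pull F (le_refl _) (res h (res (Y.basicOpen_le g) (g ^ k))) *
      res (F.preimage_mono h) s = res (preimage_basicOpen_le F g') b := by
    have := congrArg (res (F.preimage_mono h)) h1
    simpa using this
  rw [h1, h2, hP, hP, res_res]

end
end

/-! ### Gluing local counterparts of a section -/

section

variable {Y : Scheme.{0}} {F : Y ⟶ Y} {V : Y.Opens}
  {P : ∀ g : Γ(Y, V), Γ(Y, F ⁻¹ᵁ Y.basicOpen g) →+ Γ(Y, Y.basicOpen g)}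

lemma Corresponds.res {U U' : Y.Opens} (h : U' ≤ U) {s : Γ(Y, F ⁻¹ᵁ U)} {t : Γ(Y, U)}
    (H : Corresponds V P U s t) : Corresponds V P U' (res (F.preimage_mono h) s) (res h t) := by
  intro g hg
  rw [res_res, res_res, H g (hg.trans h)]

lemma Corresponds.unique
    (hdense : ∀ {U : Y.Opens} (t : Γ(Y, U)),
      (∀ (g : Γ(Y, V)) (h : Y.basicOpen g ≤ U), Toric.res h t = 0) → t = 0)
    {U : Y.Opens} {s : Γ(Y, F ⁻¹ᵁ U)} {t t' : Γ(Y, U)}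
    (H : Corresponds V P U s t) (H' : Corresponds V P U s t') : t = t' := by
  refine sub_eq_zero.1 (hdense _ fun g h ↦ ?_)
  rw [map_sub, ← H, ← H', sub_self]

lemma Corresponds.add {U : Y.Opens} {s s' : Γ(Y, F ⁻¹ᵁ U)} {t t' : Γ(Y, U)}
    (H : Corresponds V P U s t) (H' : Corresponds V P U s' t') :
    Corresponds V P U (s + s') (t + t') := by
  intro g h
  rw [map_add, map_add, map_add, H, H']

lemma Corresponds.pull_mul (hP : ∀ g, IsSemilinear (pull F le_rfl) (P g)) {U : Y.Opens}
    {s : Γ(Y, F ⁻¹ᵁ U)} {t : Γ(Y, U)} (H : Corresponds V P U s t) (a : Γ(Y, U)) :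
    Corresponds V P U (pull F le_rfl a * s) (a * t) := by
  intro g h
  rw [map_mul (Toric.res _), map_mul (Toric.res _), ← H g h, ← hP, res_pull, pull_res]

/-- If a semilinear map from functions on `F⁻¹ V` to functions on `V` respects the functions on an
affine open `U i`, then functions on opens in `F⁻¹ (U i)` have locally a counterpart. -/
lemma exists_corresponds_local {p : Γ(Y, F ⁻¹ᵁ V) →+ Γ(Y, V)}
    (hPp : ∀ g s, P g (res (preimage_basicOpen_le F g) s) = res (Y.basicOpen_le g) (p s))
    (hP : ∀ g, IsSemilinear (pull F le_rfl) (P g))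
    {U₀ : Y.Opens} (hU₀ : IsAffineOpen U₀) (hFU₀ : IsAffineOpen (F ⁻¹ᵁ U₀)) (hVU₀ : V ≤ U₀)
    (hlift : ∀ s : Γ(Y, F ⁻¹ᵁ U₀), ∃ t, res hVU₀ t = p (res (F.preimage_mono hVU₀) s))
    {U : Y.Opens} (s : Γ(Y, F ⁻¹ᵁ U)) {x : Y} (hx : x ∈ U) (hx₀ : x ∈ U₀) :
    ∃ (W : Y.Opens) (hW : W ≤ U) (t : Γ(Y, W)), x ∈ W ∧
      Corresponds V P W (res (F.preimage_mono hW) s) t := by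
  obtain ⟨f, hfU, hxf⟩ := hU₀.exists_basicOpen_le ⟨x, hx⟩ hx₀
  have hfr := isFraction_res hU₀ f rfl (Y.basicOpen_le f)
  -- Clear denominators: `s = b / (F^* f) ^ k` on `F⁻¹ D(f)`, and the counterpart of `s` is `t₀ / f
  -- ^ k`, where `t₀` extends `p b` to `U₀`.
  obtain ⟨k, b, hb⟩ := (isFraction_res hFU₀ (pull F le_rfl f) (preimage_basicOpen_eq F f)
    (preimage_basicOpen_le F f)).surj (res (F.preimage_mono hfU) s)
  obtain ⟨t₀, ht₀⟩ := hlift b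
  obtain ⟨t, ht⟩ := (hfr.isUnit.pow k).dvd (a := res (Y.basicOpen_le f) t₀)
  refine ⟨_, hfU, t, hxf, fun g hg ↦ ?_⟩
  apply ((hfr.isUnit.pow k).map (res hg)).mul_left_cancel
  rw [← map_mul, ← ht, ← hP]
  have h1 := congrArg (res (F.preimage_mono hg)) hb
  have h2 : pull F (le_refl _) (res hg (res (Y.basicOpen_le f) f ^ k)) *
      res (F.preimage_mono hg) (res (F.preimage_mono hfU) s) =
      res (preimage_basicOpen_le F g) (res (F.preimage_mono hVU₀) b) := by
    simpa using h1.symm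
  have h3 := congrArg (res (Y.basicOpen_le g)) ht₀
  rw [h2, hPp, ← h3, res_res, res_res]

/-- Counterparts are unique by density, so local ones agree on overlaps and glue. -/
lemma exists_corresponds
    (hdense : ∀ {U : Y.Opens} (t : Γ(Y, U)),
      (∀ (g : Γ(Y, V)) (h : Y.basicOpen g ≤ U), res h t = 0) → t = 0)
    (hPP : ∀ (g g' : Γ(Y, V)) (h : Y.basicOpen g' ≤ Y.basicOpen g) s,
        P g' (res (F.preimage_mono h) s) = res h (P g s))
    {U : Y.Opens} (s : Γ(Y, F ⁻¹ᵁ U))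
    (hloc : ∀ x ∈ U, ∃ (W : Y.Opens) (hW : W ≤ U) (t : Γ(Y, W)), x ∈ W ∧
      Corresponds V P W (res (F.preimage_mono hW) s) t) :
    ∃ t, Corresponds V P U s t := by
  choose W hW t hxW ht using fun x : U ↦ hloc x x.2
  have hcov : U ≤ iSup W := fun x hx ↦
    TopologicalSpace.Opens.mem_iSup.2 ⟨⟨x, hx⟩, hxW ⟨x, hx⟩⟩
  obtain ⟨T, hT⟩ : ∃ T : Γ(Y, U), ∀ x, res (hW x) T = t x := by
    refine (Y.sheaf.existsUnique_gluing' W U (fun x ↦ homOfLE (hW x)) hcov t ?_).exists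
    intro x y
    have h1 := (ht x).res (U' := W x ⊓ W y) inf_le_left
    have h2 := (ht y).res (U' := W x ⊓ W y) inf_le_right
    rw [res_res] at h1 h2
    exact h1.unique hdense h2
  refine ⟨T, fun g hg ↦ eq_of_locally_eq _ _ fun x hx ↦ ?_⟩
  -- The intersection with `W x` need not be a basic open of `V`, so density is used once more to
  -- pass to basic opens `D(g')` inside it.
  refine ⟨Y.basicOpen g ⊓ W ⟨x, hg hx⟩, inf_le_left, ⟨hx, hxW _⟩, ?_⟩
  refine sub_eq_zero.1 (hdense _ fun g' hg' ↦ ?_)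
  have h1 := ht ⟨x, hg hx⟩ g' (hg'.trans inf_le_right)
  have h2 : res (hW ⟨x, hg hx⟩) T = t ⟨x, hg hx⟩ := hT ⟨x, hg hx⟩
  rw [← h2, res_res, res_res] at h1
  rw [map_sub, res_res, res_res, res_res, ← h1, ← hPP, res_res, sub_self]

/-! ### Splittings as families of semilinear maps on sections -/

/-- The map of `𝒪_Y`-modules `F_* 𝒪_Y → 𝒪_Y` with given semilinear maps on sections. -/
def homOfSections (F : Y ⟶ Y) (f : ∀ U : Y.Opens, Γ(Y, F ⁻¹ᵁ U) →+ Γ(Y, U))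
    (hf : ∀ U, IsSemilinear (pull F le_rfl) (f U))
    (hres : ∀ (U U' : Y.Opens) (h : U' ≤ U) s, f U' (res (F.preimage_mono h) s) = res h (f U s)) :
    (Scheme.Modules.pushforward F).obj (structureModule Y) ⟶ structureModule Y :=
  ⟨PresheafOfModules.homMk
    { app := fun U ↦ AddCommGrpCat.ofHom (f U.unop)
      naturality := fun U U' i ↦ by
        ext s
        exact hres U.unop U'.unop (leOfHom i.unop) s }
    (fun U r (m : Γ(Y, F ⁻¹ᵁ U.unop)) ↦ (congrArg (fun z ↦ f U.unop (z * m)) (app_eq_pull F U.unop r)).trans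
      (hf U.unop r m))⟩

/-- The splitting with given semilinear maps on sections. -/
def splittingOfSections (F : Y ⟶ Y) (f : ∀ U : Y.Opens, Γ(Y, F ⁻¹ᵁ U) →+ Γ(Y, U))
    (hf : ∀ U, IsSemilinear (pull F le_rfl) (f U))
    (hres : ∀ (U U' : Y.Opens) (h : U' ≤ U) s, f U' (res (F.preimage_mono h) s) = res h (f U s))
    (hone : ∀ U, f U 1 = 1) : Splitting F where
  hom := homOfSections F f hf hres
  comp_hom := by
    refine Scheme.Modules.hom_ext _ _ fun U ↦ ?_
    ext (s : Γ(Y, U))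
    have := hf U s 1
    rw [mul_one, hone, mul_one, ← app_eq_pull] at this
    exact this

lemma Splitting.app_res (π : Splitting F) {U U' : Y.Opens} (h : U' ≤ U) (s : Γ(Y, F ⁻¹ᵁ U)) :
    π.app U' (res (F.preimage_mono h) s) = res h (π.app U s) :=
  ConcreteCategory.congr_hom (π.hom.mapPresheaf.naturality (homOfLE h).op) s

lemma Splitting.isSemilinear_app (π : Splitting F) (U : Y.Opens) :
    IsSemilinear (pull F le_rfl) (π.app U) := by
  intro a b
  rw [← app_eq_pull]
  exact Scheme.Modules.Hom.app_smul π.hom a b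

lemma Splitting.app_one (π : Splitting F) (U : Y.Opens) : π.app U 1 = 1 := by
  have h := congrArg (fun f : structureModule Y ⟶ structureModule Y ↦
    Scheme.Modules.Hom.app f U (1 : Γ(Y, U))) π.comp_hom
  have h1 : π.app U ((F.app U).hom 1) = 1 := h
  rwa [map_one] at h1

/-- A semilinear map from functions on `F⁻¹ V` to functions on an affine open `V` that respects the
functions on each of the affine opens `U i ⊇ V` of a cover extends to a splitting. -/
theorem exists_splitting {ι : Type*} {U : ι → Y.Opens} (hU : ∀ i, IsAffineOpen (U i))
    (hFU : ∀ i, IsAffineOpen (F ⁻¹ᵁ U i))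
    (hcov : ∀ x, ∃ i, x ∈ U i) (hV : IsAffineOpen V) (hFV : IsAffineOpen (F ⁻¹ᵁ V))
    (hVU : ∀ i, V ≤ U i) (hinj : ∀ i, Function.Injective (res (hVU i)))
    (p : Γ(Y, F ⁻¹ᵁ V) →+ Γ(Y, V)) (hp : IsSemilinear (pull F le_rfl) p) (hone : p 1 = 1)
    (hlift : ∀ i (s : Γ(Y, F ⁻¹ᵁ U i)), ∃ t, res (hVU i) t = p (res (F.preimage_mono (hVU i)) s)) :
    ∃ π : Splitting F, π.app V = p := by
  have hdense {U : Y.Opens} (t : Γ(Y, U))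
      (ht : ∀ (g : Γ(Y, V)) (h : Y.basicOpen g ≤ U), res h t = 0) : t = 0 :=
    eq_zero_of_basicOpen hU hcov hV hVU hinj t ht
  obtain ⟨P, hPp, hP, hPP⟩ := exists_localized_maps hV hFV p hp
  have hex (W : Y.Opens) (s : Γ(Y, F ⁻¹ᵁ W)) : ∃ t, Corresponds V P W s t := by
    refine exists_corresponds hdense hPP s fun x hx ↦ ?_
    obtain ⟨i, hi⟩ := hcov x
    exact exists_corresponds_local hPp hP (hU i) (hFU i) (hVU i) (hlift i) s hx hi
  choose f hf using hex
  have huniq {W : Y.Opens} {s : Γ(Y, F ⁻¹ᵁ W)} {t : Γ(Y, W)} (h : Corresponds V P W s t) :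
      f W s = t := (hf W s).unique hdense h
  let f' (W : Y.Opens) : Γ(Y, F ⁻¹ᵁ W) →+ Γ(Y, W) :=
    AddMonoidHom.mk' (f W) fun s t ↦ huniq ((hf W s).add (hf W t))
  refine ⟨splittingOfSections F f' (fun W a s ↦ huniq ((hf W s).pull_mul hP a))
    (fun W W' h s ↦ huniq ((hf W s).res h)) (fun W ↦ huniq fun g h ↦ ?_), ?_⟩
  · rw [map_one, ← map_one (res (preimage_basicOpen_le F g)), hPp, hone, map_one, map_one]
  · exact AddMonoidHom.ext fun s ↦ huniq fun g h ↦ hPp g s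

/-- Compatibility of a splitting with `i : X → Y` can be checked on an affine open `V` of `Y` and
an affine open `W` of `X` in `i⁻¹ V` by whose basic opens functions on `X` are determined. -/
theorem Splitting.isCompatibleWith_of_dense {X : Scheme.{0}} (i : X ⟶ Y) (π : Splitting F)
    (hV : IsAffineOpen V) (hFV : IsAffineOpen (F ⁻¹ᵁ V)) {W : X.Opens} (hW : IsAffineOpen W)
    (hWV : W ≤ i ⁻¹ᵁ V) (hWF : W ≤ i ⁻¹ᵁ F ⁻¹ᵁ V)
    (hdense : ∀ {U : X.Opens} (t : Γ(X, U)),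
      (∀ (g : Γ(X, W)) (h : X.basicOpen g ≤ U), res h t = 0) → t = 0)
    (hker : ∀ s, pull i hWF s = 0 → pull i hWV (π.app V s) = 0) : π.IsCompatibleWith i := by
  intro U s hs
  rw [idealOf, RingHom.mem_ker, app_eq_pull] at hs ⊢
  apply hdense
  intro w hw
  apply eq_of_locally_eq
  intro x hx
  have hxV : i x ∈ V := hWV (X.basicOpen_le w hx)
  obtain ⟨g, hgU, hxg⟩ := hV.exists_basicOpen_le ⟨i x, (hw hx : i x ∈ U)⟩ hxV
  have hD : X.basicOpen w ⊓ X.basicOpen (pull i hWV g) ≤ i ⁻¹ᵁ Y.basicOpen g := by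
    rw [basicOpen_pull]; exact inf_le_right.trans inf_le_right
  refine ⟨X.basicOpen w ⊓ X.basicOpen (pull i hWV g), inf_le_left, ⟨hx, ?_⟩, ?_⟩
  · rw [basicOpen_pull]; exact ⟨X.basicOpen_le w hx, hxg⟩
  obtain ⟨k, b, hb⟩ := (isFraction_res hFV (pull F le_rfl g) (preimage_basicOpen_eq F g)
    (preimage_basicOpen_le F g)).surj (res (F.preimage_mono hgU) s)
  have hE : X.basicOpen (pull i hWF (pull F le_rfl g)) ≤ i ⁻¹ᵁ F ⁻¹ᵁ Y.basicOpen g := by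
    rw [basicOpen_pull, preimage_basicOpen_eq F g]; exact inf_le_right
  have h0 : pull i hE (res (F.preimage_mono hgU) s) = 0 := by
    have := congrArg (res (hE.trans (i.preimage_mono (F.preimage_mono hgU)))) hs
    rwa [res_pull, map_zero, ← pull_res i hE (F.preimage_mono hgU)] at this
  have h1 : res (X.basicOpen_le (pull i hWF (pull F (le_refl (F ⁻¹ᵁ V)) g))) (pull i hWF b) = 0 := by
    have := congrArg (pull i hE) hb
    rwa [map_mul, h0, mul_zero, pull_res, ← res_pull i hWF (X.basicOpen_le _)] at this
  -- The numerator `b` of `s` is only known to vanish on a basic open of `W`. Multiplied by a power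
  -- of `F^* g` it vanishes on all of `W`, as `hker` requires, and `π` takes that power out as a
  -- power of `g`.
  obtain ⟨m, hm⟩ := (isFraction_res hW _ rfl (X.basicOpen_le _)).torsion _ h1
  rw [← map_pow, ← map_mul, ← map_pow] at hm
  have h2 := hker _ hm
  rw [π.isSemilinear_app V, map_mul, map_pow] at h2
  have h3 : res (X.basicOpen_le (pull i hWV g)) (pull i hWV (π.app V b)) = 0 := by
    have hu := (isFraction_res hW (pull i hWV g) rfl (X.basicOpen_le _)).isUnit
    apply (hu.pow m).mul_left_cancel
    rw [← map_pow, ← map_mul, h2, map_zero, mul_zero]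
  have h4 : res (Y.basicOpen_le g) g ^ k * res hgU (π.app U s) =
      res (Y.basicOpen_le g) (π.app V b) := by
    rw [← π.app_res, ← π.app_res, ← π.isSemilinear_app]
    congr 1
    rw [hb]
    simp
  have hu := ((isFraction_res hV g rfl (Y.basicOpen_le g)).isUnit.pow k).map (pull i hD)
  apply hu.mul_left_cancel
  have h5 := congrArg (pull i hD) h4
  have h6 := congrArg (res (inf_le_right : X.basicOpen w ⊓ X.basicOpen (pull i hWV g) ≤ _)) h3
  rw [map_mul, pull_res, pull_res] at h5
  rw [res_res, res_pull, map_zero] at h6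
  rw [res_pull, res_pull, map_zero, mul_zero, h5, h6]

end

/-! ### Affine charts and products -/

section

variable {X Y : Scheme.{0}}

/-- Evaluation of functions on an `R`-valued point, in particular on an affine chart. -/
def eval {R : CommRingCat.{0}} (j : Spec R ⟶ X) {U : X.Opens} (h : ⊤ ≤ j ⁻¹ᵁ U) : Γ(X, U) →+* R :=
  (Scheme.ΓSpecIso R).hom.hom.comp (pull j h)

lemma eval_res {R : CommRingCat.{0}} (j : Spec R ⟶ X) {U V : X.Opens} (h : V ≤ U)
    (h' : ⊤ ≤ j ⁻¹ᵁ V) (s : Γ(X, U)) :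
    eval j h' (res h s) = eval j (h'.trans (j.preimage_mono h)) s := by
  simp [eval]

lemma eval_pull {R : CommRingCat.{0}} (j : Spec R ⟶ X) (f : X ⟶ Y) {U : Y.Opens} {V : X.Opens}
    (h : V ≤ f ⁻¹ᵁ U) (h' : ⊤ ≤ j ⁻¹ᵁ V) (s : Γ(Y, U)) :
    eval j h' (pull f h s) = eval (j ≫ f) (h'.trans (j.preimage_mono h)) s := by
  simp only [eval, RingHom.comp_apply, pull_pull]

lemma eval_specMap {R S : CommRingCat.{0}} (φ : R ⟶ S) (j : Spec R ⟶ X) {U : X.Opens}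
    (h : ⊤ ≤ j ⁻¹ᵁ U) (h' : ⊤ ≤ (Spec.map φ ≫ j) ⁻¹ᵁ U) (s : Γ(X, U)) :
    eval (Spec.map φ ≫ j) h' s = φ.hom (eval j h s) := by
  have h1 : pull (Spec.map φ ≫ j) h' s = pull (Spec.map φ) le_top (pull j h s) :=
    (pull_pull _ _ _ _ _).symm
  simp only [eval, RingHom.comp_apply, h1]
  generalize pull j h s = t
  have h2 : pull (Spec.map φ) le_top t = ((Spec.map φ).appTop).hom t := by
    simp only [pull, Scheme.Hom.appTop, Scheme.Hom.app_eq_appLE]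
    rfl
  rw [h2]
  exact ConcreteCategory.congr_hom (Scheme.ΓSpecIso_naturality φ) t

lemma eval_bijective {R : CommRingCat.{0}} (j : Spec R ⟶ X) [IsOpenImmersion j] {U : X.Opens}
    (hU : U = j.opensRange) (h : ⊤ ≤ j ⁻¹ᵁ U) : Function.Bijective (eval j h) := by
  obtain rfl : U = j ''ᵁ ⊤ := hU.trans j.image_top_eq_opensRange.symm
  have h1 : Function.Bijective (pull j h) := by
    have : pull j h = (j.appIso ⊤).hom.hom := by rw [Scheme.Hom.appIso_hom']; rfl
    rw [this]
    exact ConcreteCategory.bijective_of_isIso (j.appIso ⊤).hom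
  exact (ConcreteCategory.bijective_of_isIso (Scheme.ΓSpecIso R).hom).comp h1

lemma opensRange_eq_of_isPullback {P A B C : Scheme.{0}} {fst : P ⟶ A} {snd : P ⟶ B} {f : A ⟶ C}
    {g : B ⟶ C} (sq : IsPullback fst snd f g) [IsOpenImmersion f] [IsOpenImmersion snd] :
    snd.opensRange = g ⁻¹ᵁ f.opensRange := by
  rw [← Scheme.Hom.opensRange_pullbackSnd, ← Scheme.Hom.opensRange_comp_of_isIso
    sq.isoPullback.hom (pullback.snd f g)]
  congr 1
  simp

/-- As a base change of `f`, the map `prod.map (𝟙 X) f` is an open immersion when `f` is. -/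
lemma isPullback_prodMap_id_left {C : Type*} [Category* C] {A B : C} (f : A ⟶ B) (X : C)
    [HasBinaryProduct X A] [HasBinaryProduct X B] :
    IsPullback prod.snd (prod.map (𝟙 X) f) f prod.snd where
  isLimit' := ⟨PullbackCone.isLimitAux' _ (fun s ↦ by
    have h₂ : prod.lift (s.snd ≫ prod.fst) s.fst ≫ prod.snd = s.fst := prod.lift_snd _ _
    have h₃ : prod.lift (s.snd ≫ prod.fst) s.fst ≫ prod.map (𝟙 X) f = s.snd := by
      rw [prod.lift_map, Category.comp_id, PullbackCone.condition]
      exact (prod.comp_lift s.snd prod.fst prod.snd).symm.trans (by simp)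
    refine ⟨prod.lift (s.snd ≫ prod.fst) s.fst, h₂, h₃, fun {m'} h₁ h₂ ↦ ?_⟩
    obtain ⟨m, hm⟩ : ∃ m : s.pt ⟶ X ⨯ A, m = m' := ⟨m', rfl⟩
    subst hm
    replace h₁ : m ≫ prod.snd = s.fst := h₁
    replace h₂ : m ≫ prod.map (𝟙 X) f = s.snd := h₂
    apply Limits.prod.hom_ext
    · rw [prod.lift_fst, ← h₂, Category.assoc, prod.map_fst, Category.comp_id]
    · rw [prod.lift_snd, h₁])⟩

/-- The product of two open immersions is an open immersion, with the expected range. -/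
lemma isOpenImmersion_prodLift {A B W : Scheme.{0}} {a : W ⟶ A} {b : W ⟶ B}
    (hW : IsLimit (BinaryFan.mk a b)) (f : A ⟶ X) (g : B ⟶ Y) [IsOpenImmersion f]
    [IsOpenImmersion g] :
    ∃ _ : IsOpenImmersion (prod.lift (a ≫ f) (b ≫ g)),
      (prod.lift (a ≫ f) (b ≫ g)).opensRange =
        (prod.fst : X ⨯ Y ⟶ X) ⁻¹ᵁ f.opensRange ⊓ (prod.snd : X ⨯ Y ⟶ Y) ⁻¹ᵁ g.opensRange := by
  have sq₁ := IsPullback.of_prod_fst_with_id f Y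
  have sq₂ := isPullback_prodMap_id_left g A
  have : IsOpenImmersion (prod.map f (𝟙 Y)) :=
    MorphismProperty.of_isPullback sq₁ (P := @IsOpenImmersion) inferInstance
  have : IsOpenImmersion (prod.map (𝟙 A) g) :=
    MorphismProperty.of_isPullback sq₂ (P := @IsOpenImmersion) inferInstance
  let e : W ≅ A ⨯ B := hW.conePointUniqueUpToIso (limit.isLimit (pair A B))
  have h1 : e.hom ≫ prod.fst = a :=
    hW.conePointUniqueUpToIso_hom_comp (limit.isLimit (pair A B)) ⟨.left⟩
  have h2 : e.hom ≫ prod.snd = b :=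
    hW.conePointUniqueUpToIso_hom_comp (limit.isLimit (pair A B)) ⟨.right⟩
  have he : prod.lift (a ≫ f) (b ≫ g) = e.hom ≫ prod.map (𝟙 A) g ≫ prod.map f (𝟙 Y) := by
    apply Limits.prod.hom_ext
    · rw [prod.lift_fst, ← h1]; simp
    · rw [prod.lift_snd, ← h2]; simp
  have : IsOpenImmersion (prod.lift (a ≫ f) (b ≫ g)) := by rw [he]; infer_instance
  refine ⟨this, ?_⟩
  have hr : (prod.lift (a ≫ f) (b ≫ g)).opensRange =
      (prod.map (𝟙 A) g ≫ prod.map f (𝟙 Y)).opensRange := by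
    rw [← Scheme.Hom.opensRange_comp_of_isIso e.hom]
    congr 1
  rw [hr, Scheme.Hom.opensRange_comp, opensRange_eq_of_isPullback sq₂]
  have h3 : (prod.snd : A ⨯ Y ⟶ Y) = prod.map f (𝟙 Y) ≫ prod.snd := by simp
  rw [h3, Scheme.Hom.comp_preimage, Scheme.Hom.image_preimage_eq_opensRange_inf,
    opensRange_eq_of_isPullback sq₁]

end

/-! ### Monoid rings of products, the Frobenius and the diagonal -/

section

variable (S T : Type) [AddCommMonoid S] [AddCommMonoid T]

/-- The ring map `ℤ[S] → ℤ[S × T]`. -/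
def inlRingHom : AddMonoidAlgebra ℤ S →+* AddMonoidAlgebra ℤ (S × T) :=
  AddMonoidAlgebra.mapDomainRingHom ℤ (AddMonoidHom.inl S T)

/-- The ring map `ℤ[T] → ℤ[S × T]`. -/
def inrRingHom : AddMonoidAlgebra ℤ T →+* AddMonoidAlgebra ℤ (S × T) :=
  AddMonoidAlgebra.mapDomainRingHom ℤ (AddMonoidHom.inr S T)

/-- The ring map `x^u ↦ x^{qu}`. -/
def powRingHom (q : ℕ) :
    AddMonoidAlgebra ℤ S →+* AddMonoidAlgebra ℤ S :=
  AddMonoidAlgebra.mapDomainRingHom ℤ (nsmulAddMonoidHom q)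

/-- The ring map `ℤ[S × S] → ℤ[S]` of the diagonal, `x^{(u, w)} ↦ x^{u + w}`. -/
def addRingHom :
    AddMonoidAlgebra ℤ (S × S) →+* AddMonoidAlgebra ℤ S :=
  AddMonoidAlgebra.mapDomainRingHom ℤ (AddMonoidHom.coprod (.id S) (.id S))

variable {S T}

lemma addMonoidAlgebra_ringHom_ext {C : Type*} [Semiring C] {f g : AddMonoidAlgebra ℤ S →+* C}
    (h : ∀ s, f (.single s 1) = g (.single s 1)) : f = g :=
  AddMonoidAlgebra.ringHom_ext (fun r ↦ by
    have : (f.comp AddMonoidAlgebra.singleZeroRingHom) = (g.comp AddMonoidAlgebra.singleZeroRingHom) :=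
      RingHom.ext_int _ _
    exact congrArg (fun φ ↦ φ r) this) h

lemma powRingHom_single (q : ℕ) (s : S) (r : ℤ) :
    powRingHom S q (.single s r) = .single (q • s) r := by
  rw [powRingHom, AddMonoidAlgebra.mapDomainRingHom_apply, AddMonoidAlgebra.mapDomain_single]
  rfl

lemma addRingHom_single (s t : S) (r : ℤ) :
    addRingHom S (.single (s, t) r) = .single (s + t) r := by
  rw [addRingHom, AddMonoidAlgebra.mapDomainRingHom_apply, AddMonoidAlgebra.mapDomain_single]
  rfl

lemma inlRingHom_single (s : S) (r : ℤ) : inlRingHom S T (.single s r) = .single (s, 0) r := by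
  rw [inlRingHom, AddMonoidAlgebra.mapDomainRingHom_apply, AddMonoidAlgebra.mapDomain_single]
  rfl

lemma inrRingHom_single (t : T) (r : ℤ) : inrRingHom S T (.single t r) = .single (0, t) r := by
  rw [inrRingHom, AddMonoidAlgebra.mapDomainRingHom_apply, AddMonoidAlgebra.mapDomain_single]
  rfl

lemma inlRingHom_comp_powRingHom (q : ℕ) :
    (inlRingHom S T).comp (powRingHom S q) = (powRingHom (S × T) q).comp (inlRingHom S T) :=
  addMonoidAlgebra_ringHom_ext fun s ↦ by
    rw [RingHom.comp_apply, RingHom.comp_apply, powRingHom_single, inlRingHom_single,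
      inlRingHom_single, powRingHom_single, Prod.smul_mk, smul_zero]

lemma inrRingHom_comp_powRingHom (q : ℕ) :
    (inrRingHom S T).comp (powRingHom T q) = (powRingHom (S × T) q).comp (inrRingHom S T) :=
  addMonoidAlgebra_ringHom_ext fun s ↦ by
    rw [RingHom.comp_apply, RingHom.comp_apply, powRingHom_single, inrRingHom_single,
      inrRingHom_single, powRingHom_single, Prod.smul_mk, smul_zero]

/-- The ring map from `ℤ[S × T]` given by ring maps from `ℤ[S]` and `ℤ[T]`. -/
def prodDesc {C : Type*} [CommRing C] (f : AddMonoidAlgebra ℤ S →+* C)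
    (g : AddMonoidAlgebra ℤ T →+* C) : AddMonoidAlgebra ℤ (S × T) →+* C :=
  (AddMonoidAlgebra.lift ℤ C (S × T)
    { toFun := fun x ↦ f (.single x.toAdd.1 1) * g (.single x.toAdd.2 1)
      map_one' := by
        simp [← AddMonoidAlgebra.one_def]
      map_mul' := fun x y ↦ by
        have h1 : (AddMonoidAlgebra.single (x.toAdd.1 + y.toAdd.1) 1 : AddMonoidAlgebra ℤ S) =
          .single x.toAdd.1 1 * .single y.toAdd.1 1 := by
          rw [AddMonoidAlgebra.single_mul_single, one_mul]
        have h2 : (AddMonoidAlgebra.single (x.toAdd.2 + y.toAdd.2) 1 : AddMonoidAlgebra ℤ T) =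
          .single x.toAdd.2 1 * .single y.toAdd.2 1 := by
          rw [AddMonoidAlgebra.single_mul_single, one_mul]
        simp only [toAdd_mul, Prod.fst_add, Prod.snd_add, h1, h2, map_mul]
        ring } : AddMonoidAlgebra ℤ (S × T) →ₐ[ℤ] C)

lemma prodDesc_single {C : Type*} [CommRing C] (f : AddMonoidAlgebra ℤ S →+* C)
    (g : AddMonoidAlgebra ℤ T →+* C) (s : S) (t : T) :
    prodDesc f g (.single (s, t) 1) = f (.single s 1) * g (.single t 1) := by
  simp [prodDesc, AddMonoidAlgebra.lift_single]

lemma prodDesc_comp_inl {C : Type*} [CommRing C] (f : AddMonoidAlgebra ℤ S →+* C)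
    (g : AddMonoidAlgebra ℤ T →+* C) : (prodDesc f g).comp (inlRingHom S T) = f := by
  refine addMonoidAlgebra_ringHom_ext fun s ↦ ?_
  rw [RingHom.comp_apply, inlRingHom, AddMonoidAlgebra.mapDomainRingHom_apply,
    AddMonoidAlgebra.mapDomain_single, AddMonoidHom.inl_apply, prodDesc_single,
    ← AddMonoidAlgebra.one_def, map_one, mul_one]

lemma prodDesc_comp_inr {C : Type*} [CommRing C] (f : AddMonoidAlgebra ℤ S →+* C)
    (g : AddMonoidAlgebra ℤ T →+* C) : (prodDesc f g).comp (inrRingHom S T) = g := by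
  refine addMonoidAlgebra_ringHom_ext fun s ↦ ?_
  rw [RingHom.comp_apply, inrRingHom, AddMonoidAlgebra.mapDomainRingHom_apply,
    AddMonoidAlgebra.mapDomain_single, AddMonoidHom.inr_apply, prodDesc_single,
    ← AddMonoidAlgebra.one_def, map_one, one_mul]

lemma eq_prodDesc {C : Type*} [CommRing C] (f : AddMonoidAlgebra ℤ S →+* C)
    (g : AddMonoidAlgebra ℤ T →+* C) (m : AddMonoidAlgebra ℤ (S × T) →+* C)
    (hf : m.comp (inlRingHom S T) = f) (hg : m.comp (inrRingHom S T) = g) : m = prodDesc f g := by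
  refine addMonoidAlgebra_ringHom_ext fun ⟨s, t⟩ ↦ ?_
  rw [prodDesc_single, ← hf, ← hg, RingHom.comp_apply, RingHom.comp_apply, ← map_mul]
  simp [inlRingHom, inrRingHom, AddMonoidAlgebra.single_mul_single]

variable (S T) in
/-- `Spec ℤ[S × T]` is the product of `Spec ℤ[S]` and `Spec ℤ[T]`. -/
def specProdIsLimit :
    IsLimit (BinaryFan.mk (Spec.map (CommRingCat.ofHom (inlRingHom S T)))
      (Spec.map (CommRingCat.ofHom (inrRingHom S T)))) := by
  have h : IsLimit (BinaryFan.mk (CommRingCat.ofHom (inlRingHom S T)).op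
      (CommRingCat.ofHom (inrRingHom S T)).op) :=
    BinaryFan.IsLimit.mk _ (fun f g ↦ (CommRingCat.ofHom (prodDesc f.unop.hom g.unop.hom)).op)
      (fun f g ↦ Quiver.Hom.unop_inj (CommRingCat.hom_ext (prodDesc_comp_inl _ _)))
      (fun f g ↦ Quiver.Hom.unop_inj (CommRingCat.hom_ext (prodDesc_comp_inr _ _)))
      (fun f g m hf hg ↦ Quiver.Hom.unop_inj (CommRingCat.hom_ext
        (eq_prodDesc _ _ _ (by subst hf; rfl) (by subst hg; rfl))))
  exact mapIsLimitOfPreservesOfIsLimit Scheme.Spec _ _ h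

end

/-! ### The charts of a toric variety -/

lemma dualMonoid_anti {n : ℕ} {τ σ : PointedCone ℝ (Fin n → ℝ)} (h : τ ≤ σ) :
    dualMonoid σ ≤ dualMonoid τ :=
  fun _ hu v hv ↦ hu v (h hv)

namespace Fan

variable {n : ℕ} (Φ : Fan n)

/-- The chart `U_σ → X`. -/
def chart (σ : Φ.Index) :
    Spec (.of (AddMonoidAlgebra ℤ (dualMonoid σ.1))) ⟶ Φ.toricVariety :=
  colimit.ι Φ.diagram σ

instance (σ : Φ.Index) : IsOpenImmersion (Φ.chart σ) :=
  inferInstanceAs (IsOpenImmersion (colimit.ι Φ.diagram σ))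

lemma map_chart {τ σ : Φ.Index} (h : τ.1 ≤ σ.1) :
    Spec.map (CommRingCat.ofHom (restrictionMap h)) ≫ Φ.chart σ = Φ.chart τ :=
  colimit.w Φ.diagram (homOfLE h : τ ⟶ σ)

lemma chart_frobenius (q : ℕ) (σ : Φ.Index) : Φ.chart σ ≫ Φ.frobenius q =
    Spec.map (CommRingCat.ofHom (chartFrobenius q σ.1)) ≫ Φ.chart σ :=
  ι_colimMap _ _

lemma exists_mem_opensRange_chart (x : Φ.toricVariety) : ∃ σ, x ∈ (Φ.chart σ).opensRange := by
  obtain ⟨σ, y, hy⟩ := Scheme.IsLocallyDirected.ι_jointly_surjective Φ.diagram x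
  exact ⟨σ, y, hy⟩

/-- If `x` in `U_τ` has image in `U_σ`, the image lies in some `U_ρ` with `ρ` a face of both cones,
and `U_ρ` is the basic open of a monomial in `U_τ`. The Frobenius pulls this monomial back to its
`q`-th power, so `x` already lies in `U_ρ`. -/
lemma frobenius_preimage_chart {q : ℕ} (hq : q ≠ 0) (σ : Φ.Index) :
    Φ.frobenius q ⁻¹ᵁ (Φ.chart σ).opensRange = (Φ.chart σ).opensRange := by
  have happ (τ : Φ.Index) (y) : Φ.frobenius q (Φ.chart τ y) =
      Φ.chart τ (Spec.map (CommRingCat.ofHom (chartFrobenius q τ.1)) y) := by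
    rw [← Scheme.Hom.comp_apply, chart_frobenius, Scheme.Hom.comp_apply]
  apply le_antisymm
  · intro x hx
    obtain ⟨τ, y, rfl⟩ := Φ.exists_mem_opensRange_chart x
    obtain ⟨z, hz⟩ : ∃ z, Φ.chart σ z = Φ.frobenius q (Φ.chart τ y) := hx
    rw [happ] at hz
    obtain ⟨ρ, f, g, w, hwz, hwy⟩ := (Scheme.IsLocallyDirected.ι_eq_ι_iff Φ.diagram).1 hz
    obtain ⟨u, hu, hρ⟩ := Φ.isFace_of_le (leOfHom g)
    have hr := range_comap_restrictionMap (Φ.rational _ τ.2) hu hρ (leOfHom g)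
    have h1 : Spec.map (CommRingCat.ofHom (chartFrobenius q τ.1)) y ∈ PrimeSpectrum.basicOpen
        (AddMonoidAlgebra.single (⟨u, hu⟩ : dualMonoid τ.1) (1 : ℤ)) :=
      (Set.ext_iff.1 hr _).1 ⟨w, hwy⟩
    have h2 : y ∈ PrimeSpectrum.basicOpen
        (AddMonoidAlgebra.single (⟨u, hu⟩ : dualMonoid τ.1) (1 : ℤ)) := by
      have h3 : chartFrobenius q τ.1 (AddMonoidAlgebra.single (⟨u, hu⟩ : dualMonoid τ.1) (1 : ℤ)) =
          AddMonoidAlgebra.single (⟨u, hu⟩ : dualMonoid τ.1) (1 : ℤ) ^ q := by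
        rw [AddMonoidAlgebra.single_pow, one_pow, chartFrobenius,
          AddMonoidAlgebra.mapDomainRingHom_apply, AddMonoidAlgebra.mapDomain_single]
        rfl
      rw [← PrimeSpectrum.basicOpen_pow _ q (Nat.pos_of_ne_zero hq), ← h3]
      exact h1
    obtain ⟨(w' : Spec (.of (AddMonoidAlgebra ℤ (dualMonoid ρ.1)))), hw'⟩ :=
      (Set.ext_iff.1 hr y).2 h2
    refine ⟨Spec.map (CommRingCat.ofHom (restrictionMap (leOfHom f))) w', ?_⟩
    have hw'' : Spec.map (CommRingCat.ofHom (restrictionMap (leOfHom g))) w' = y := hw'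
    rw [← hw'', ← Scheme.Hom.comp_apply, ← Scheme.Hom.comp_apply, map_chart, map_chart]
  · rintro _ ⟨y, rfl⟩
    exact ⟨Spec.map (CommRingCat.ofHom (chartFrobenius q σ.1)) y, (happ σ y).symm⟩

/-- The chart `U_σ × U_τ → X × X`. -/
def prodChart (i : Φ.Index × Φ.Index) :
    Spec (.of (AddMonoidAlgebra ℤ (dualMonoid i.1.1 × dualMonoid i.2.1))) ⟶
      Φ.toricVariety ⨯ Φ.toricVariety :=
  prod.lift (Spec.map (CommRingCat.ofHom (inlRingHom _ _)) ≫ Φ.chart i.1)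
    (Spec.map (CommRingCat.ofHom (inrRingHom _ _)) ≫ Φ.chart i.2)

instance (i : Φ.Index × Φ.Index) : IsOpenImmersion (Φ.prodChart i) :=
  (isOpenImmersion_prodLift (specProdIsLimit _ _) (Φ.chart i.1) (Φ.chart i.2)).1

lemma opensRange_prodChart (i : Φ.Index × Φ.Index) : (Φ.prodChart i).opensRange =
    (prod.fst : Φ.toricVariety ⨯ Φ.toricVariety ⟶ _) ⁻¹ᵁ (Φ.chart i.1).opensRange ⊓
      (prod.snd : Φ.toricVariety ⨯ Φ.toricVariety ⟶ _) ⁻¹ᵁ (Φ.chart i.2).opensRange :=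
  (isOpenImmersion_prodLift (specProdIsLimit _ _) (Φ.chart i.1) (Φ.chart i.2)).2

lemma exists_mem_opensRange_prodChart (x : (Φ.toricVariety ⨯ Φ.toricVariety : Scheme)) :
    ∃ i, x ∈ (Φ.prodChart i).opensRange := by
  obtain ⟨σ, hσ⟩ := Φ.exists_mem_opensRange_chart
    ((prod.fst : Φ.toricVariety ⨯ Φ.toricVariety ⟶ _) x)
  obtain ⟨τ, hτ⟩ := Φ.exists_mem_opensRange_chart
    ((prod.snd : Φ.toricVariety ⨯ Φ.toricVariety ⟶ _) x)
  exact ⟨(σ, τ), by rw [opensRange_prodChart]; exact ⟨hσ, hτ⟩⟩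

/-- The lifted Frobenius `F × F` of `X × X`. -/
abbrev prodFrobenius (q : ℕ) :
    Φ.toricVariety ⨯ Φ.toricVariety ⟶ Φ.toricVariety ⨯ Φ.toricVariety :=
  prod.map (Φ.frobenius q) (Φ.frobenius q)

lemma prodFrobenius_preimage_prodChart {q : ℕ} (hq : q ≠ 0) (i : Φ.Index × Φ.Index) :
    Φ.prodFrobenius q ⁻¹ᵁ (Φ.prodChart i).opensRange = (Φ.prodChart i).opensRange := by
  have h1 : Φ.prodFrobenius q ≫ prod.fst = prod.fst ≫ Φ.frobenius q := prod.map_fst _ _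
  have h2 : Φ.prodFrobenius q ≫ prod.snd = prod.snd ≫ Φ.frobenius q := prod.map_snd _ _
  rw [opensRange_prodChart, Scheme.Hom.preimage_inf, ← Scheme.Hom.comp_preimage,
    ← Scheme.Hom.comp_preimage, h1, h2, Scheme.Hom.comp_preimage, Scheme.Hom.comp_preimage,
    frobenius_preimage_chart Φ hq, frobenius_preimage_chart Φ hq]

variable {Φ} in
/-- The ring map `ℤ[(σ^∨ ∩ M) × (τ^∨ ∩ M)] → ℤ[(σ'^∨ ∩ M) × (τ'^∨ ∩ M)]` for cones `σ' ⊆ σ` and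
`τ' ⊆ τ`. -/
def prodRestriction {i j : Φ.Index × Φ.Index} (h : i ≤ j) :
    AddMonoidAlgebra ℤ (dualMonoid j.1.1 × dualMonoid j.2.1) →+*
      AddMonoidAlgebra ℤ (dualMonoid i.1.1 × dualMonoid i.2.1) :=
  AddMonoidAlgebra.mapDomainRingHom ℤ (AddMonoidHom.prodMap
    (AddSubmonoid.inclusion (dualMonoid_anti h.1))
    (AddSubmonoid.inclusion (dualMonoid_anti h.2)))

lemma prodRestriction_single {i j : Φ.Index × Φ.Index} (h : i ≤ j) (u : dualMonoid j.1.1)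
    (w : dualMonoid j.2.1) (r : ℤ) : prodRestriction h (.single (u, w) r) =
      .single (⟨u, dualMonoid_anti h.1 u.2⟩, ⟨w, dualMonoid_anti h.2 w.2⟩) r := by
  rw [prodRestriction, AddMonoidAlgebra.mapDomainRingHom_apply, AddMonoidAlgebra.mapDomain_single]
  rfl

lemma prodRestriction_injective {i j : Φ.Index × Φ.Index} (h : i ≤ j) :
    Function.Injective (prodRestriction h) :=
  AddMonoidAlgebra.mapDomain_injective (f := Prod.map (AddSubmonoid.inclusion _)
    (AddSubmonoid.inclusion _)) (Function.Injective.prodMap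
      (AddSubmonoid.inclusion_injective (dualMonoid_anti h.1))
      (AddSubmonoid.inclusion_injective (dualMonoid_anti h.2)))

lemma map_prodChart {i j : Φ.Index × Φ.Index} (h : i ≤ j) :
    Spec.map (CommRingCat.ofHom (prodRestriction h)) ≫ Φ.prodChart j = Φ.prodChart i := by
  apply Limits.prod.hom_ext
  · rw [prodChart, prodChart, Category.assoc, prod.lift_fst, prod.lift_fst, ← Φ.map_chart h.1,
      ← Category.assoc, ← Category.assoc, ← Spec.map_comp, ← Spec.map_comp, ← CommRingCat.ofHom_comp,
      ← CommRingCat.ofHom_comp]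
    have : (prodRestriction h).comp (inlRingHom _ _) = (inlRingHom _ _).comp (restrictionMap h.1) :=
      addMonoidAlgebra_ringHom_ext fun s ↦ by simp [inlRingHom, prodRestriction, restrictionMap]
    rw [this]
  · rw [prodChart, prodChart, Category.assoc, prod.lift_snd, prod.lift_snd, ← Φ.map_chart h.2,
      ← Category.assoc, ← Category.assoc, ← Spec.map_comp, ← Spec.map_comp, ← CommRingCat.ofHom_comp,
      ← CommRingCat.ofHom_comp]
    have : (prodRestriction h).comp (inrRingHom _ _) = (inrRingHom _ _).comp (restrictionMap h.2) :=
      addMonoidAlgebra_ringHom_ext fun s ↦ by simp [inrRingHom, prodRestriction, restrictionMap]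
    rw [this]

lemma opensRange_prodChart_mono {i j : Φ.Index × Φ.Index} (h : i ≤ j) :
    (Φ.prodChart i).opensRange ≤ (Φ.prodChart j).opensRange := by
  rintro _ ⟨x, rfl⟩
  refine ⟨Spec.map (CommRingCat.ofHom (prodRestriction h)) x, ?_⟩
  rw [← Scheme.Hom.comp_apply, map_prodChart]

lemma prodChart_prodFrobenius (q : ℕ) (i : Φ.Index × Φ.Index) :
    Φ.prodChart i ≫ Φ.prodFrobenius q =
      Spec.map (CommRingCat.ofHom (powRingHom _ q)) ≫ Φ.prodChart i := by
  apply Limits.prod.hom_ext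
  · rw [Category.assoc, Category.assoc, prod.map_fst, prodChart, prod.lift_fst, prod.lift_fst_assoc,
      Category.assoc, chart_frobenius, ← Category.assoc, ← Category.assoc, ← Spec.map_comp,
      ← Spec.map_comp, ← CommRingCat.ofHom_comp, ← CommRingCat.ofHom_comp]
    exact congrArg (fun φ ↦ Spec.map (CommRingCat.ofHom φ) ≫ Φ.chart i.1)
      (inlRingHom_comp_powRingHom q)
  · rw [Category.assoc, Category.assoc, prod.map_snd, prodChart, prod.lift_snd, prod.lift_snd_assoc,
      Category.assoc, chart_frobenius, ← Category.assoc, ← Category.assoc, ← Spec.map_comp,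
      ← Spec.map_comp, ← CommRingCat.ofHom_comp, ← CommRingCat.ofHom_comp]
    exact congrArg (fun φ ↦ Spec.map (CommRingCat.ofHom φ) ≫ Φ.chart i.2)
      (inrRingHom_comp_powRingHom q)

lemma chart_diag (σ : Φ.Index) : Φ.chart σ ≫ diag Φ.toricVariety =
    Spec.map (CommRingCat.ofHom (addRingHom _)) ≫ Φ.prodChart (σ, σ) := by
  apply Limits.prod.hom_ext
  · rw [Category.assoc, Category.assoc, prod.lift_fst, prodChart, prod.lift_fst, Category.comp_id,
      ← Category.assoc, ← Spec.map_comp, ← CommRingCat.ofHom_comp]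
    have : (addRingHom (dualMonoid σ.1)).comp (inlRingHom _ _) = RingHom.id _ :=
      addMonoidAlgebra_ringHom_ext fun s ↦ by simp [inlRingHom, addRingHom]
    rw [this, CommRingCat.ofHom_id, Spec.map_id, Category.id_comp]
  · rw [Category.assoc, Category.assoc, prod.lift_snd, prodChart, prod.lift_snd, Category.comp_id,
      ← Category.assoc, ← Spec.map_comp, ← CommRingCat.ofHom_comp]
    have : (addRingHom (dualMonoid σ.1)).comp (inrRingHom _ _) = RingHom.id _ :=
      addMonoidAlgebra_ringHom_ext fun s ↦ by simp [inrRingHom, addRingHom]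
    rw [this, CommRingCat.ofHom_id, Spec.map_id, Category.id_comp]

lemma diag_preimage_prodChart (σ : Φ.Index) :
    diag Φ.toricVariety ⁻¹ᵁ (Φ.prodChart (σ, σ)).opensRange = (Φ.chart σ).opensRange := by
  rw [opensRange_prodChart, Scheme.Hom.preimage_inf, ← Scheme.Hom.comp_preimage,
    ← Scheme.Hom.comp_preimage, prod.lift_fst, prod.lift_snd, Scheme.Hom.id_preimage, inf_idem]

end Fan

lemma eval_eq_of_comp {X : Scheme.{0}} {R S : Type} [CommRing R] [CommRing S] (φ : R →+* S)
    {j : Spec (.of R) ⟶ X} {j' : Spec (.of S) ⟶ X} (hj : Spec.map (CommRingCat.ofHom φ) ≫ j = j')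
    {U : X.Opens} (h : ⊤ ≤ j ⁻¹ᵁ U) (h' : ⊤ ≤ j' ⁻¹ᵁ U) (s : Γ(X, U)) :
    eval j' h' s = φ (eval j h s) := by
  subst hj
  exact eval_specMap _ _ h h' s

/-! ### Functions on the charts and the reduction to the torus -/

namespace Fan

variable {n : ℕ} (Φ : Fan n)

/-- The range of the chart `U_σ`. -/
abbrev chartOpen (σ : Φ.Index) : Φ.toricVariety.Opens := (Φ.chart σ).opensRange

/-- The range of the chart `U_σ × U_τ`. -/
abbrev prodOpen (i : Φ.Index × Φ.Index) : (Φ.toricVariety ⨯ Φ.toricVariety : Scheme).Opens :=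
  (Φ.prodChart i).opensRange

lemma chartOpen_mono {τ σ : Φ.Index} (h : τ ≤ σ) : Φ.chartOpen τ ≤ Φ.chartOpen σ := by
  rintro _ ⟨x, rfl⟩
  refine ⟨Spec.map (CommRingCat.ofHom (restrictionMap h)) x, ?_⟩
  rw [← Scheme.Hom.comp_apply, map_chart]

/-- Functions on the chart `U_σ`. -/
def chartEquiv (σ : Φ.Index) : Γ(Φ.toricVariety, Φ.chartOpen σ) ≃+*
    AddMonoidAlgebra ℤ (dualMonoid σ.1) :=
  RingEquiv.ofBijective (eval (Φ.chart σ) (Φ.chart σ).preimage_opensRange.ge)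
    (eval_bijective _ rfl _)

/-- Functions on the chart `U_σ × U_τ`. -/
def prodEquiv (i : Φ.Index × Φ.Index) : Γ(Φ.toricVariety ⨯ Φ.toricVariety, Φ.prodOpen i) ≃+*
    AddMonoidAlgebra ℤ (dualMonoid i.1.1 × dualMonoid i.2.1) :=
  RingEquiv.ofBijective (eval (Φ.prodChart i) (Φ.prodChart i).preimage_opensRange.ge)
    (eval_bijective _ rfl _)

/-- Functions on the preimage of the chart `U_σ × U_τ` under `F × F`. -/
def frobEquiv {q : ℕ} (hq : q ≠ 0) (i : Φ.Index × Φ.Index) :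
    Γ(Φ.toricVariety ⨯ Φ.toricVariety, Φ.prodFrobenius q ⁻¹ᵁ Φ.prodOpen i) ≃+*
      AddMonoidAlgebra ℤ (dualMonoid i.1.1 × dualMonoid i.2.1) :=
  RingEquiv.ofBijective (eval (Φ.prodChart i) (by
      rw [prodFrobenius_preimage_prodChart Φ hq]; exact (Φ.prodChart i).preimage_opensRange.ge))
    (eval_bijective _ (prodFrobenius_preimage_prodChart Φ hq i) _)

variable {Φ}

lemma chartEquiv_res {τ σ : Φ.Index} (h : τ ≤ σ) (s) :
    Φ.chartEquiv τ (res (Φ.chartOpen_mono h) s) = restrictionMap h (Φ.chartEquiv σ s) := by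
  simp only [chartEquiv, RingEquiv.ofBijective_apply]
  rw [eval_res]
  exact eval_eq_of_comp _ (Φ.map_chart h) _ _ _

lemma prodEquiv_res {i j : Φ.Index × Φ.Index} (h : i ≤ j) (s) :
    Φ.prodEquiv i (res (Φ.opensRange_prodChart_mono h) s) =
      prodRestriction h (Φ.prodEquiv j s) := by
  simp only [prodEquiv, RingEquiv.ofBijective_apply]
  rw [eval_res]
  exact eval_eq_of_comp _ (Φ.map_prodChart h) _ _ _

lemma frobEquiv_res {q : ℕ} (hq : q ≠ 0) {i j : Φ.Index × Φ.Index} (h : i ≤ j) (s) :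
    Φ.frobEquiv hq i (res ((Φ.prodFrobenius q).preimage_mono (Φ.opensRange_prodChart_mono h)) s) =
      prodRestriction h (Φ.frobEquiv hq j s) := by
  simp only [frobEquiv, RingEquiv.ofBijective_apply]
  rw [eval_res]
  exact eval_eq_of_comp _ (Φ.map_prodChart h) _ _ _

lemma frobEquiv_pull {q : ℕ} (hq : q ≠ 0) (i : Φ.Index × Φ.Index) (s) :
    Φ.frobEquiv hq i (pull (Φ.prodFrobenius q) le_rfl s) = powRingHom _ q (Φ.prodEquiv i s) := by
  simp only [frobEquiv, prodEquiv, RingEquiv.ofBijective_apply]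
  rw [eval_pull]
  exact eval_eq_of_comp _ (Φ.prodChart_prodFrobenius q i).symm _ _ _

lemma chartOpen_le_diag_preimage_frobenius {q : ℕ} (hq : q ≠ 0) (σ : Φ.Index) :
    Φ.chartOpen σ ≤ diag Φ.toricVariety ⁻¹ᵁ Φ.prodFrobenius q ⁻¹ᵁ Φ.prodOpen (σ, σ) := by
  rw [prodFrobenius_preimage_prodChart Φ hq]
  exact (Φ.diag_preimage_prodChart σ).ge

lemma chartEquiv_pull_diag (σ : Φ.Index) (s) :
    Φ.chartEquiv σ (pull (diag Φ.toricVariety) (Φ.diag_preimage_prodChart σ).ge s) =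
      addRingHom _ (Φ.prodEquiv (σ, σ) s) := by
  simp only [chartEquiv, prodEquiv, RingEquiv.ofBijective_apply]
  rw [eval_pull]
  exact eval_eq_of_comp _ (Φ.chart_diag σ).symm _ _ _

lemma chartEquiv_pull_diag_frobenius {q : ℕ} (hq : q ≠ 0) (σ : Φ.Index) (s) :
    Φ.chartEquiv σ (pull (diag Φ.toricVariety) (chartOpen_le_diag_preimage_frobenius hq σ) s) =
      addRingHom _ (Φ.frobEquiv hq (σ, σ) s) := by
  simp only [chartEquiv, frobEquiv, RingEquiv.ofBijective_apply]
  rw [eval_pull]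
  exact eval_eq_of_comp _ (Φ.chart_diag σ).symm _ _ _

lemma isAffineOpen_prodFrobenius_preimage {q : ℕ} (hq : q ≠ 0) (i : Φ.Index × Φ.Index) :
    IsAffineOpen (Φ.prodFrobenius q ⁻¹ᵁ Φ.prodOpen i) := by
  rw [prodFrobenius_preimage_prodChart Φ hq]
  exact isAffineOpen_opensRange _

/-- A diagonal splitting of `X × X` is the same as a map on the ring of functions of the torus that
is compatible with the diagonal and with the charts. -/
theorem isDiagonallySplit_iff {q : ℕ} (hq : q ≠ 0) {o : Φ.Index} (ho : ∀ σ : Φ.Index, o ≤ σ) :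
    Φ.IsDiagonallySplit q ↔
      ∃ p : AddMonoidAlgebra ℤ (dualMonoid o.1 × dualMonoid o.1) →+
          AddMonoidAlgebra ℤ (dualMonoid o.1 × dualMonoid o.1),
        IsSemilinear (powRingHom _ q) p ∧ p 1 = 1 ∧
        (∀ (i : Φ.Index × Φ.Index) (h : (o, o) ≤ i) (s), ∃ t,
          prodRestriction h t = p (prodRestriction h s)) ∧
        ∀ s, addRingHom _ s = 0 → addRingHom _ (p s) = 0 := by
  constructor
  · rintro ⟨π, hπ⟩
    let p := (Φ.prodEquiv (o, o)).toAddEquiv.toAddMonoidHom.comp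
      ((π.app (Φ.prodOpen (o, o))).comp (Φ.frobEquiv hq (o, o)).symm.toAddEquiv.toAddMonoidHom)
    have hp (s) : p s =
      Φ.prodEquiv (o, o) (π.app (Φ.prodOpen (o, o)) ((Φ.frobEquiv hq (o, o)).symm s)) := rfl
    refine ⟨p, fun a s ↦ ?_, ?_, fun i h s ↦ ?_, fun s hs ↦ ?_⟩
    · obtain ⟨a, rfl⟩ := (Φ.prodEquiv (o, o)).surjective a
      obtain ⟨s, rfl⟩ := (Φ.frobEquiv hq (o, o)).surjective s
      have h1 : (Φ.frobEquiv hq (o, o)).symm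
          (powRingHom _ q (Φ.prodEquiv (o, o) a) * Φ.frobEquiv hq (o, o) s) =
            pull (Φ.prodFrobenius q) le_rfl a * s := by
        rw [RingEquiv.symm_apply_eq, map_mul, frobEquiv_pull]
      rw [hp, hp, RingEquiv.symm_apply_apply]
      refine (congrArg (fun z ↦ Φ.prodEquiv (o, o) (π.app (Φ.prodOpen (o, o)) z)) h1).trans ?_
      rw [π.isSemilinear_app, map_mul]
    · rw [hp, map_one, π.app_one, map_one]
    · obtain ⟨s, rfl⟩ := (Φ.frobEquiv hq i).surjective s
      refine ⟨Φ.prodEquiv i (π.app _ s), ?_⟩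
      rw [hp, ← frobEquiv_res hq h, RingEquiv.symm_apply_apply,
        π.app_res (Φ.opensRange_prodChart_mono h), prodEquiv_res h]
    · obtain ⟨s, rfl⟩ := (Φ.frobEquiv hq (o, o)).surjective s
      -- An element of the kernel of `x^(u,w) ↦ x^(u+w)` is a function vanishing on the diagonal
      -- torus.
      have h1 : s ∈ idealOf (diag Φ.toricVariety) (Φ.prodFrobenius q ⁻¹ᵁ Φ.prodOpen (o, o)) := by
        rw [idealOf, RingHom.mem_ker, app_eq_pull]
        have h2 : diag Φ.toricVariety ⁻¹ᵁ Φ.prodFrobenius q ⁻¹ᵁ Φ.prodOpen (o, o) ≤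
            Φ.chartOpen o := by
          rw [prodFrobenius_preimage_prodChart Φ hq, Φ.diag_preimage_prodChart]
        rw [← chartEquiv_pull_diag_frobenius, map_eq_zero_iff _ (RingEquiv.injective _)] at hs
        have := congrArg (res h2) hs
        rwa [map_zero, res_pull] at this
      have h2 := hπ _ _ h1
      rw [idealOf, RingHom.mem_ker, app_eq_pull] at h2
      rw [hp, RingEquiv.symm_apply_apply, ← chartEquiv_pull_diag]
      have := congrArg (res (Φ.diag_preimage_prodChart o).ge) h2
      rw [map_zero, res_pull] at this
      rw [this, map_zero]
  · rintro ⟨p₀, hp₀, hone, hlift, hker⟩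
    let p := (Φ.prodEquiv (o, o)).symm.toAddEquiv.toAddMonoidHom.comp
      (p₀.comp (Φ.frobEquiv hq (o, o)).toAddEquiv.toAddMonoidHom)
    have hp (s) : p s = (Φ.prodEquiv (o, o)).symm (p₀ (Φ.frobEquiv hq (o, o) s)) := rfl
    have hoi (i : Φ.Index × Φ.Index) : (o, o) ≤ i := ⟨ho i.1, ho i.2⟩
    -- Restriction to the torus is an inclusion of monoid rings; this is the density that both
    -- extension theorems need.
    have hinjX (σ : Φ.Index) : Function.Injective (res (Φ.chartOpen_mono (ho σ))) := by
      intro s t hst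
      have h1 := congrArg (Φ.chartEquiv o) hst
      rw [chartEquiv_res (ho σ), chartEquiv_res (ho σ)] at h1
      exact (Φ.chartEquiv σ).injective (restrictionMap_injective _ h1)
    have hinj (i) : Function.Injective (res (Φ.opensRange_prodChart_mono (hoi i))) := by
      intro s t hst
      have h1 := congrArg (Φ.prodEquiv (o, o)) hst
      rw [prodEquiv_res (hoi i), prodEquiv_res (hoi i)] at h1
      exact (Φ.prodEquiv i).injective (Φ.prodRestriction_injective _ h1)
    obtain ⟨π, hπ⟩ := exists_splitting (F := Φ.prodFrobenius q) (U := Φ.prodOpen)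
      (V := Φ.prodOpen (o, o)) (fun i ↦ isAffineOpen_opensRange _)
      (isAffineOpen_prodFrobenius_preimage hq)
      Φ.exists_mem_opensRange_prodChart (isAffineOpen_opensRange _)
      (isAffineOpen_prodFrobenius_preimage hq _)
      (fun i ↦ Φ.opensRange_prodChart_mono (hoi i)) hinj p
      (fun a s ↦ by rw [hp, hp, map_mul, frobEquiv_pull, hp₀, map_mul, RingEquiv.symm_apply_apply])
      (by rw [hp, map_one, hone, map_one])
      (fun i s ↦ by
        obtain ⟨t, ht⟩ := hlift i (hoi i) (Φ.frobEquiv hq i s)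
        refine ⟨(Φ.prodEquiv i).symm t, (Φ.prodEquiv (o, o)).injective ?_⟩
        rw [prodEquiv_res (hoi i), RingEquiv.apply_symm_apply, hp, RingEquiv.apply_symm_apply,
          frobEquiv_res hq (hoi i), ht])
    refine ⟨π, π.isCompatibleWith_of_dense (V := Φ.prodOpen (o, o)) (diag Φ.toricVariety)
      (W := Φ.chartOpen o)
      (isAffineOpen_opensRange _) (isAffineOpen_prodFrobenius_preimage hq _)
      (isAffineOpen_opensRange _) (Φ.diag_preimage_prodChart o).ge
      (chartOpen_le_diag_preimage_frobenius hq o) (fun t ht ↦ ?_) fun s hs ↦ ?_⟩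
    · exact eq_zero_of_basicOpen (U := Φ.chartOpen) (fun i ↦ isAffineOpen_opensRange _)
        Φ.exists_mem_opensRange_chart (isAffineOpen_opensRange _)
        (fun σ ↦ Φ.chartOpen_mono (ho σ)) hinjX t ht
    · apply (Φ.chartEquiv o).injective
      rw [map_zero, chartEquiv_pull_diag, hπ, hp, RingEquiv.apply_symm_apply]
      apply hker
      rw [← chartEquiv_pull_diag_frobenius, hs, map_zero]

end Fan

/-! ### Rational polyhedral cones -/

/-- **Gordan's theorem** over an ordered field, relative to a subspace: if no nontrivial nonnegative
combination of finitely many vectors lies in `W`, then some functional vanishes on `W` and is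
positive on all of them. -/
theorem exists_functional_pos {K V ι : Type*} [Field K] [LinearOrder K] [IsStrictOrderedRing K]
    [AddCommGroup V] [Module K V] (S : Finset ι) (w : ι → V) (W : Submodule K V)
    (h : ∀ c : ι → K, (∀ i, 0 ≤ c i) → ∑ i ∈ S, c i • w i ∈ W → ∀ i ∈ S, c i = 0) :
    ∃ f : V →ₗ[K] K, (∀ x ∈ W, f x = 0) ∧ ∀ i ∈ S, 0 < f (w i) := by
  classical
  induction S using Finset.induction_on generalizing W with
  | empty => exact ⟨0, by simp, by simp⟩
  | insert a S ha ih =>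
    by_cases hA : ∀ c : ι → K, (∀ i, 0 ≤ c i) →
        ∑ i ∈ S, c i • w i ∈ W ⊔ Submodule.span K {w a} → ∀ i ∈ S, c i = 0
    · obtain ⟨g, hgW, hg⟩ := ih _ hA
      have haW : w a ∉ W := by
        intro haW
        have := h (fun i ↦ if i = a then 1 else 0) (fun i ↦ by split_ifs <;> simp) (by
          rw [Finset.sum_insert ha, if_pos rfl, one_smul, Finset.sum_eq_zero, add_zero]
          · exact haW
          · intro i hi
            rw [if_neg (by rintro rfl; exact ha hi), zero_smul]) a (Finset.mem_insert_self _ _)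
        simp at this
      obtain ⟨l, hla, hlW⟩ := Submodule.exists_le_ker_of_notMem haW
      have hga : g (w a) = 0 :=
        hgW _ (Submodule.mem_sup_right (Submodule.mem_span_singleton_self _))
      obtain ⟨N, hN⟩ : ∃ N : K, ∀ i ∈ S, -(l (w a) * l (w i)) < N * g (w i) := by
        obtain ⟨N, hN⟩ := (S.image fun i ↦ -(l (w a) * l (w i)) / g (w i)).exists_le
        refine ⟨N + 1, fun i hi ↦ ?_⟩
        have := hN _ (Finset.mem_image_of_mem _ hi)
        rw [div_le_iff₀ (hg i hi)] at this
        linarith [hg i hi]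
      -- At `w a` the value is the square of `l (w a)`, since `g` vanishes there; on `S` the term `N
      -- • g` outweighs the other.
      refine ⟨N • g + l (w a) • l, fun x hx ↦ ?_, fun i hi ↦ ?_⟩
      · have h1 : l x = 0 := hlW hx
        simp [hgW x (Submodule.mem_sup_left hx), h1]
      · rcases Finset.mem_insert.1 hi with rfl | hi
        · simpa [hga] using mul_self_pos.2 hla
        · have := hN i hi
          simp only [LinearMap.add_apply, LinearMap.smul_apply, smul_eq_mul]
          linarith
    · push Not at hA
      obtain ⟨c, hc, hcW, j, hj, hcj⟩ := hA
      obtain ⟨y, hy, z, hz, hyz⟩ := Submodule.mem_sup.1 hcW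
      obtain ⟨t, rfl⟩ := Submodule.mem_span_singleton.1 hz
      have hsum (t' : K) : ∑ i ∈ insert a S, (if i = a then t' else c i) • w i =
          t' • w a + ∑ i ∈ S, c i • w i := by
        rw [Finset.sum_insert ha, if_pos rfl]
        congr 1
        refine Finset.sum_congr rfl fun i hi ↦ ?_
        rw [if_neg (by rintro rfl; exact ha hi)]
      -- If `t ≤ 0`, moving `t • w a` to the other side gives a forbidden relation. So modulo `W` a
      -- positive multiple of `w a` is a nontrivial nonnegative combination of `S`, and a functional
      -- that vanishes on `W` and is positive on `S` is positive at `w a`.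
      have ht : 0 < t := by
        by_contra ht
        have := h (fun i ↦ if i = a then -t else c i)
          (fun i ↦ by split_ifs; exacts [by linarith, hc i])
          (by rw [hsum, ← hyz, neg_smul, neg_add_cancel_comm_assoc]; exact hy) j
          (Finset.mem_insert_of_mem hj)
        rw [if_neg (by rintro rfl; exact ha hj)] at this
        exact hcj this
      obtain ⟨f, hfW, hf⟩ := ih W (fun d hd hdW i hi ↦ by
        have := h (fun i ↦ if i = a then 0 else d i)
          (fun i ↦ by split_ifs; exacts [le_rfl, hd i]) (by
            rw [Finset.sum_insert ha, if_pos rfl, zero_smul, zero_add]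
            convert! hdW using 1
            refine Finset.sum_congr rfl fun i hi ↦ ?_
            rw [if_neg (by rintro rfl; exact ha hi)]) i (Finset.mem_insert_of_mem hi)
        rwa [if_neg (by rintro rfl; exact ha hi)] at this)
      refine ⟨f, hfW, fun i hi ↦ ?_⟩
      rcases Finset.mem_insert.1 hi with rfl | hi
      · have h1 := congrArg f hyz
        rw [map_add, hfW y hy, zero_add, map_smul, map_sum, smul_eq_mul] at h1
        have h2 : 0 < ∑ i ∈ S, f (c i • w i) := by
          refine Finset.sum_pos' (fun k hk ↦ ?_) ⟨j, hj, ?_⟩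
          · rw [map_smul]; exact mul_nonneg (hc k) (hf k hk).le
          · rw [map_smul]; exact mul_pos (lt_of_le_of_ne (hc j) (Ne.symm hcj)) (hf j hj)
        rw [← h1] at h2
        exact pos_of_mul_pos_right h2 ht.le
      · exact hf i hi

lemma incl_dotProduct_incl {n : ℕ} (u v : Fin n → ℤ) :
    incl n u ⬝ᵥ incl n v = ((u ⬝ᵥ v : ℤ) : ℝ) := by
  simp [dotProduct, incl]

lemma incl_injective (n : ℕ) : Function.Injective (incl n) := by
  intro u v h
  ext i
  exact Int.cast_injective (congrFun h i)

/-- A functional on `ℚⁿ` is, up to a positive multiple, given by a lattice point. -/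
lemma exists_int_dotProduct {n : ℕ} (f : (Fin n → ℚ) →ₗ[ℚ] ℚ) :
    ∃ (d : ℤ) (u : Fin n → ℤ), 0 < d ∧
      ∀ v : Fin n → ℤ, ((u ⬝ᵥ v : ℤ) : ℚ) = d * f (fun i ↦ (v i : ℚ)) := by
  obtain ⟨d, hd⟩ := IsLocalization.exist_integer_multiples_of_finite (nonZeroDivisors ℤ)
    (fun i : Fin n ↦ f (Pi.single i 1))
  choose u hu using hd
  have hd0 : (d : ℤ) ≠ 0 := nonZeroDivisors.coe_ne_zero d
  have hf (v : Fin n → ℤ) : f (fun i ↦ (v i : ℚ)) = ∑ i, (v i : ℚ) * f (Pi.single i 1) := by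
    conv_lhs => rw [← Finset.univ_sum_single (fun i ↦ (v i : ℚ))]
    rw [map_sum]
    refine Finset.sum_congr rfl fun i _ ↦ ?_
    rw [← smul_eq_mul, ← map_smul, ← Pi.single_smul, smul_eq_mul, mul_one]
  -- The common denominator `d` may be negative; its square is not.
  refine ⟨d * d, fun i ↦ d * u i, mul_self_pos.2 hd0, fun v ↦ ?_⟩
  rw [hf, Finset.mul_sum, dotProduct, Int.cast_sum]
  refine Finset.sum_congr rfl fun i _ ↦ ?_
  have := hu i
  simp only [algebraMap_int_eq, eq_intCast, Algebra.smul_def] at this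
  push_cast
  rw [this]
  ring

section

variable {n : ℕ}

lemma real_smul_mem {σ : PointedCone ℝ (Fin n → ℝ)} {x : Fin n → ℝ} (hx : x ∈ σ) {c : ℝ}
    (hc : 0 ≤ c) : c • x ∈ σ :=
  σ.smul_mem hc hx

/-- A lattice functional that vanishes on a lattice point `v` of a strongly convex cone and is
positive on the other generators of the cone. -/
lemma exists_functional_of_salient {σ : PointedCone ℝ (Fin n → ℝ)} {S : Finset (Fin n → ℤ)}
    (hS : σ = PointedCone.hull ℝ (incl n '' S)) (h0 : 0 ∉ S)
    (hσ : (σ : ConvexCone ℝ (Fin n → ℝ)).Salient) {v : Fin n → ℤ} (hv : incl n v ∈ σ)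
    (hirr : ∀ t : ℝ, 0 < t → t • incl n v ∈ PointedCone.hull ℝ (incl n '' (S.erase v : Finset _)) →
      v = 0) :
    ∃ u : Fin n → ℤ, u ⬝ᵥ v = 0 ∧ ∀ w ∈ S, w ≠ v → 0 < u ⬝ᵥ w := by
  classical
  let e : (Fin n → ℤ) → Fin n → ℚ := fun w i ↦ (w i : ℚ)
  -- Gordan's theorem is applied over ℚ, so that the functional can be scaled to a lattice point,
  -- and modulo the line of `v`, so that it vanishes on `v`.
  obtain ⟨f, hfv, hf⟩ := exists_functional_pos (S.erase v) e (Submodule.span ℚ {e v}) (by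
    intro c hc hcv
    obtain ⟨t, ht⟩ := Submodule.mem_span_singleton.1 hcv
    by_contra! hne
    obtain ⟨j, hj, hcj⟩ := hne
    have hR : (t : ℝ) • incl n v = ∑ w ∈ S.erase v, (c w : ℝ) • incl n w := by
      ext i
      have := congrFun ht i
      simp only [Pi.smul_apply, Finset.sum_apply, smul_eq_mul, e] at this
      simp only [Pi.smul_apply, Finset.sum_apply, smul_eq_mul]
      change (t : ℝ) * (v i : ℝ) = ∑ w ∈ S.erase v, (c w : ℝ) * (w i : ℝ)
      exact_mod_cast congrArg (Rat.cast : ℚ → ℝ) this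
    have hmem (w) (hw : w ∈ S) : incl n w ∈ σ := by
      rw [hS]; exact PointedCone.subset_hull ⟨w, hw, rfl⟩
    -- Either way `-t v` is in `σ`. The conclusion `v = 0` in `hirr` admits two uses: `v` an
    -- irredundant generator, where the premise never holds, and `v = 0`.
    have hle : (t : ℝ) • incl n v = 0 ∨ t ≤ 0 := by
      by_cases htp : 0 < t
      · left
        have := hirr t (by exact_mod_cast htp) (by
          rw [hR]
          exact Submodule.sum_mem _ fun w hw ↦ real_smul_mem (PointedCone.subset_hull
            (Set.mem_image_of_mem _ (Finset.mem_coe.2 hw))) (by exact_mod_cast hc w))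
        rw [this, map_zero, smul_zero]
      · exact Or.inr (not_lt.1 htp)
    have hj' : (c j : ℝ) • incl n j ∈ σ :=
      real_smul_mem (hmem j (Finset.mem_of_mem_erase hj)) (by exact_mod_cast hc j)
    refine hσ _ hj' ?_ ?_
    · refine smul_ne_zero (by exact_mod_cast hcj) fun h ↦ h0 ?_
      rw [← incl_injective n (h.trans (map_zero _).symm)]
      exact Finset.mem_of_mem_erase hj
    -- The relation puts the negative of the nonzero vector `c j • j` into `σ`, against strong
    -- convexity.
    · have h1 : -((c j : ℝ) • incl n j) =
          (∑ w ∈ (S.erase v).erase j, (c w : ℝ) • incl n w) + -((t : ℝ) • incl n v) := by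
        rw [hR, ← Finset.add_sum_erase _ _ hj]
        abel
      rw [h1]
      change _ ∈ σ
      refine add_mem (Submodule.sum_mem _ fun w hw ↦ real_smul_mem
        (hmem w (Finset.mem_of_mem_erase (Finset.mem_of_mem_erase hw))) (by exact_mod_cast hc w)) ?_
      rcases hle with h | h
      · rw [h, neg_zero]; exact zero_mem _
      · rw [← neg_smul]
        exact real_smul_mem hv (by have : (t : ℝ) ≤ 0 := by exact_mod_cast h
                                   linarith))
  obtain ⟨d, u, hd, hu⟩ := exists_int_dotProduct f
  have hd' : (0 : ℚ) < d := by exact_mod_cast hd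
  refine ⟨u, ?_, fun w hw hwv ↦ ?_⟩
  · have := hu v
    rw [hfv _ (Submodule.mem_span_singleton_self (e v)), mul_zero] at this
    exact_mod_cast this
  · have := mul_pos hd' (hf w (Finset.mem_erase.2 ⟨hwv, hw⟩))
    rw [← hu w] at this
    exact_mod_cast this

/-- In a nonnegative combination of the generators every term other than that of `v` contributes
positively to `u`, so where `u` vanishes only a multiple of `v` remains. -/
lemma isFace_hull_singleton {σ : PointedCone ℝ (Fin n → ℝ)} {S : Finset (Fin n → ℤ)}
    (hS : σ = PointedCone.hull ℝ (incl n '' S)) {v : Fin n → ℤ} (hv : incl n v ∈ σ)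
    {u : Fin n → ℤ} (huv : u ⬝ᵥ v = 0) (hu : ∀ w ∈ S, w ≠ v → 0 < u ⬝ᵥ w) :
    IsFace (PointedCone.hull ℝ {incl n v}) σ := by
  have huv' : incl n u ⬝ᵥ incl n v = 0 := by rw [incl_dotProduct_incl, huv, Int.cast_zero]
  have key : ∀ x ∈ σ, 0 ≤ incl n u ⬝ᵥ x ∧
      (incl n u ⬝ᵥ x = 0 → x ∈ PointedCone.hull ℝ {incl n v}) := by
    intro x hx
    rw [hS] at hx
    induction hx using Submodule.span_induction with
    | mem x hx =>
      obtain ⟨w, hw, rfl⟩ := hx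
      by_cases hwv : w = v
      · subst hwv
        exact ⟨huv'.ge, fun _ ↦ PointedCone.subset_hull rfl⟩
      · have : 0 < incl n u ⬝ᵥ incl n w := by
          rw [incl_dotProduct_incl]; exact_mod_cast hu w hw hwv
        exact ⟨this.le, fun h ↦ absurd h this.ne'⟩
    | zero => exact ⟨by simp, fun _ ↦ zero_mem _⟩
    | add x y _ _ hx hy =>
      rw [dotProduct_add]
      exact ⟨add_nonneg hx.1 hy.1, fun h ↦ add_mem (hx.2 (by linarith [hx.1, hy.1]))
        (hy.2 (by linarith [hx.1, hy.1]))⟩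
    | smul a x _ hx =>
      have : incl n u ⬝ᵥ (a • x) = (a : ℝ) * (incl n u ⬝ᵥ x) := dotProduct_smul (a : ℝ) _ _
      rw [this]
      refine ⟨mul_nonneg a.2 hx.1, fun h ↦ ?_⟩
      rcases mul_eq_zero.1 h with h | h
      · have : a = 0 := Subtype.ext h
        rw [this, zero_smul]
        exact zero_mem _
      · exact Submodule.smul_mem _ a (hx.2 h)
  refine ⟨u, fun x hx ↦ (key x hx).1, fun x ↦ ⟨fun hx ↦ ?_, fun hx ↦ (key x hx.1).2 hx.2⟩⟩
  obtain ⟨a, rfl⟩ := Submodule.mem_span_singleton.1 hx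
  refine ⟨Submodule.smul_mem _ a hv, ?_⟩
  have : incl n u ⬝ᵥ (a • incl n v) = (a : ℝ) * (incl n u ⬝ᵥ incl n v) :=
    dotProduct_smul (a : ℝ) _ _
  rw [this, huv', mul_zero]

/-- A rational cone has an irredundant finite set of generators. -/
lemma IsRational.exists_irredundant {σ : PointedCone ℝ (Fin n → ℝ)} (hσ : IsRational σ) :
    ∃ S : Finset (Fin n → ℤ), σ = PointedCone.hull ℝ (incl n '' S) ∧ 0 ∉ S ∧
      ∀ v ∈ S, ∀ t : ℝ, 0 < t →
        t • incl n v ∉ PointedCone.hull ℝ (incl n '' (S.erase v : Finset _)) := by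
  classical
  have hex : ∃ (k : ℕ) (S : Finset (Fin n → ℤ)), S.card = k ∧
      σ = PointedCone.hull ℝ (incl n '' S) := by
    obtain ⟨s, hs, rfl⟩ := hσ
    exact ⟨_, hs.toFinset, rfl, by simp⟩
  -- Take a generating set of least cardinality: a generator with a positive multiple in the hull of
  -- the others could be dropped.
  obtain ⟨S, hcard, hS⟩ := Nat.find_spec hex
  have hirr (v) (hv : v ∈ S) (t : ℝ) (ht : 0 < t) :
      t • incl n v ∉ PointedCone.hull ℝ (incl n '' (S.erase v : Finset _)) := by
    intro h
    refine Nat.find_min hex (m := (S.erase v).card) ?_ ⟨S.erase v, rfl, le_antisymm ?_ ?_⟩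
    · rw [← hcard]; exact Finset.card_erase_lt_of_mem hv
    · rw [hS]
      refine Submodule.span_le.2 ?_
      rintro _ ⟨w, hw, rfl⟩
      by_cases hwv : w = v
      · have h2 := real_smul_mem h (inv_nonneg.2 ht.le)
        rw [smul_smul, inv_mul_cancel₀ ht.ne', one_smul] at h2
        rw [hwv]; exact h2
      · exact PointedCone.subset_hull ⟨w, Finset.mem_erase.2 ⟨hwv, hw⟩, rfl⟩
    · rw [hS]
      exact Submodule.span_mono (Set.image_mono (Finset.coe_subset.2 (Finset.erase_subset v S)))
  refine ⟨S, hS, fun h0 ↦ hirr 0 h0 1 one_pos ?_, hirr⟩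
  rw [map_zero, smul_zero]
  exact zero_mem _

/-- A functional positive on all nonzero generators cuts out the zero face; this is the case `v = 0`
of the two lemmas above. -/
lemma Fan.bot_mem (Φ : Fan n) {σ : PointedCone ℝ (Fin n → ℝ)} (hσ : σ ∈ Φ.cones) :
    ⊥ ∈ Φ.cones := by
  obtain ⟨S, hS, h0, -⟩ := (Φ.rational σ hσ).exists_irredundant
  have hz : incl n 0 ∈ σ := by rw [map_zero]; exact zero_mem _
  obtain ⟨u, hu0, hu⟩ := exists_functional_of_salient hS h0 (Φ.stronglyConvex σ hσ) hz
    fun _ _ _ ↦ rfl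
  have := Φ.face_mem σ hσ _ (isFace_hull_singleton hS hz hu0 hu)
  rwa [map_zero, PointedCone.hull, Submodule.span_zero_singleton] at this

/-! ### Primitive lattice points -/

/-- The coordinates of `v` generate an ideal `(d)`, and `v` is `d` times a lattice point, so `d` is
a unit and Bézout coefficients give `m`. -/
lemma IsPrimitive.exists_dotProduct_eq_one {v : Fin n → ℤ} (hv : IsPrimitive v) :
    ∃ m : Fin n → ℤ, m ⬝ᵥ v = 1 := by
  obtain ⟨d, hd⟩ := IsPrincipalIdealRing.principal (Ideal.span (Set.range v))
  have hdvd (i) : d ∣ v i := Ideal.mem_span_singleton.1 (by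
    have : v i ∈ Ideal.span (Set.range v) := Ideal.subset_span ⟨i, rfl⟩
    rwa [hd] at this)
  choose w hw using hdvd
  have hunit := hv d w (funext fun i ↦ by rw [hw]; rfl)
  have h1 : (1 : ℤ) ∈ Ideal.span (Set.range v) := by
    rw [hd]
    exact Ideal.mem_span_singleton.2 hunit.dvd
  obtain ⟨m, hm⟩ := Ideal.mem_span_range_iff_exists_fun.1 h1
  exact ⟨m, hm⟩

lemma isPrimitive_of_dotProduct_eq_one {m v : Fin n → ℤ} (h : m ⬝ᵥ v = 1) : IsPrimitive v := by
  rintro k w rfl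
  rw [dotProduct_smul, smul_eq_mul] at h
  exact IsUnit.of_mul_eq_one _ h

lemma exists_isPrimitive {v : Fin n → ℤ} (hv : v ≠ 0) :
    ∃ (k : ℤ) (w : Fin n → ℤ), 0 < k ∧ IsPrimitive w ∧ v = k • w := by
  obtain ⟨d, hd⟩ := IsPrincipalIdealRing.principal (Ideal.span (Set.range v))
  have hdvd (i) : d ∣ v i := Ideal.mem_span_singleton.1 (by
    have : v i ∈ Ideal.span (Set.range v) := Ideal.subset_span ⟨i, rfl⟩
    rwa [hd] at this)
  choose w hw using hdvd
  have hvw : v = d • w := funext fun i ↦ by rw [hw]; rfl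
  have hd0 : d ≠ 0 := by rintro rfl; exact hv (by rw [hvw, zero_smul])
  have hdm : d ∈ Ideal.span (Set.range v) := by rw [hd]; exact Ideal.mem_span_singleton_self d
  obtain ⟨m, hm⟩ := Ideal.mem_span_range_iff_exists_fun.1 hdm
  replace hm : m ⬝ᵥ v = d := hm
  have hmw : m ⬝ᵥ w = 1 := by
    rw [hvw, dotProduct_smul, smul_eq_mul] at hm
    exact mul_left_cancel₀ hd0 (by rw [hm, mul_one])
  rcases lt_or_gt_of_ne hd0 with h | h
  · exact ⟨-d, -w, by omega, isPrimitive_of_dotProduct_eq_one (m := -m) (by simpa using hmw),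
      by rw [hvw]; simp⟩
  · exact ⟨d, w, h, isPrimitive_of_dotProduct_eq_one hmw, hvw⟩

/-! ### The rays of a fan -/

lemma hull_singleton_zsmul {k : ℤ} (hk : 0 < k) (w : Fin n → ℤ) :
    PointedCone.hull ℝ {incl n (k • w)} = PointedCone.hull ℝ {incl n w} := by
  have hk' : (0 : ℝ) < k := by exact_mod_cast hk
  have hkw : incl n (k • w) = (k : ℝ) • incl n w := by ext i; simp [incl]
  apply le_antisymm
  · refine Submodule.span_le.2 (Set.singleton_subset_iff.2 ?_)
    rw [hkw]
    exact real_smul_mem (PointedCone.subset_hull (Set.mem_singleton _)) hk'.le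
  · refine Submodule.span_le.2 (Set.singleton_subset_iff.2 ?_)
    have hmem : incl n (k • w) ∈ PointedCone.hull ℝ {incl n (k • w)} :=
      PointedCone.subset_hull (Set.mem_singleton _)
    have := real_smul_mem hmem (inv_nonneg.2 hk'.le)
    rw [hkw, smul_smul, inv_mul_cancel₀ hk'.ne', one_smul, ← hkw] at this
    exact this

/-- A lattice functional that is nonnegative on the rays of a cone of a fan is nonnegative on the
cone. -/
theorem Fan.mem_dualMonoid_of_rays (Φ : Fan n) {σ : PointedCone ℝ (Fin n → ℝ)} (hσ : σ ∈ Φ.cones)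
    {u : Fin n → ℤ} (hu : ∀ v ∈ Φ.rayGenerators, incl n v ∈ σ → 0 ≤ u ⬝ᵥ v) :
    u ∈ dualMonoid σ := by
  obtain ⟨S, hS, h0, hirr⟩ := (Φ.rational σ hσ).exists_irredundant
  have key : ∀ v ∈ S, 0 ≤ u ⬝ᵥ v := by
    intro v hv
    have hvσ : incl n v ∈ σ := by rw [hS]; exact PointedCone.subset_hull ⟨v, hv, rfl⟩
    obtain ⟨l, hlv, hl⟩ := exists_functional_of_salient hS h0 (Φ.stronglyConvex σ hσ) hvσ
      fun t ht h ↦ absurd h (hirr v hv t ht)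
    -- An irredundant generator spans a face, hence a ray of the fan, so the hypothesis on rays
    -- applies to its primitive multiple.
    have hface := Φ.face_mem σ hσ _ (isFace_hull_singleton hS hvσ hlv hl)
    obtain ⟨k, w, hk, hw, rfl⟩ := exists_isPrimitive (ne_of_mem_of_not_mem hv h0)
    rw [hull_singleton_zsmul hk] at hface
    have hwσ : PointedCone.hull ℝ {incl n w} ≤ σ := by
      rw [← hull_singleton_zsmul hk]
      exact Submodule.span_le.2 (Set.singleton_subset_iff.2 hvσ)
    rw [dotProduct_smul, smul_eq_mul]
    exact mul_nonneg hk.le (hu w ⟨hw, hface⟩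
      (hwσ (PointedCone.subset_hull (Set.mem_singleton _))))
  intro x hx
  rw [hS] at hx
  induction hx using Submodule.span_induction with
  | mem x hx =>
    obtain ⟨v, hv, rfl⟩ := hx
    rw [incl_dotProduct_incl]
    exact_mod_cast key v hv
  | zero => simp
  | add x y _ _ hx hy => rw [dotProduct_add]; exact add_nonneg hx hy
  | smul a x _ hx =>
    have : incl n u ⬝ᵥ (a • x) = (a : ℝ) * (incl n u ⬝ᵥ x) := dotProduct_smul (a : ℝ) _ _
    rw [this]
    exact mul_nonneg a.2 hx

/-- A ray determines its primitive generator: the ratio of two of them is an integer, by pairing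
with `m`, and it is a nonnegative unit. -/
lemma Fan.finite_rayGenerators (Φ : Fan n) : Φ.rayGenerators.Finite := by
  refine Set.Finite.of_finite_image (f := fun v ↦ PointedCone.hull ℝ {incl n v})
    (Φ.finite.subset ?_) ?_
  · rintro _ ⟨v, hv, rfl⟩
    exact hv.2
  · rintro v hv w hw h
    have hmem : incl n w ∈ PointedCone.hull ℝ {incl n v} := by
      have : incl n w ∈ PointedCone.hull ℝ {incl n w} := PointedCone.subset_hull rfl
      rwa [← show PointedCone.hull ℝ {incl n v} = PointedCone.hull ℝ {incl n w} from h] at this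
    obtain ⟨a, ha⟩ := Submodule.mem_span_singleton.1 hmem
    obtain ⟨m, hm⟩ := hv.1.exists_dotProduct_eq_one
    have h1 : (a : ℝ) = ((m ⬝ᵥ w : ℤ) : ℝ) := by
      have h2 : incl n m ⬝ᵥ (a • incl n v) = (a : ℝ) * (incl n m ⬝ᵥ incl n v) :=
        dotProduct_smul (a : ℝ) _ _
      rw [ha, incl_dotProduct_incl, incl_dotProduct_incl, hm, Int.cast_one, mul_one] at h2
      exact h2.symm
    have h3 : w = (m ⬝ᵥ w) • v := by
      apply incl_injective n
      rw [← ha]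
      ext i
      have : (a • incl n v) i = (a : ℝ) * (v i : ℝ) := rfl
      rw [this, h1]
      simp [incl]
    have h4 := hw.1 _ _ h3
    have h5 : 0 ≤ m ⬝ᵥ w := by
      have := a.2
      rw [show ((a : ℝ)) = _ from h1] at this
      exact_mod_cast this
    rcases Int.isUnit_iff.1 h4 with h6 | h6
    · rw [h3, h6, one_smul]
    · omega

/-! ### The interior of the diagonal splitting polytope -/

/-- Finitely many strict inequalities define an open set. Conversely, an interior point can be moved
a little both ways along `m` with `⟨m, v⟩ = 1`, which excludes equality at `v`. -/
lemma Fan.mem_interior_diagonalSplittingPolytope (Φ : Fan n) {u : Fin n → ℝ} :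
    u ∈ interior Φ.diagonalSplittingPolytope ↔
      ∀ v ∈ Φ.rayGenerators, -1 < u ⬝ᵥ incl n v ∧ u ⬝ᵥ incl n v < 1 := by
  have hcont (v : Fin n → ℝ) : Continuous fun u : Fin n → ℝ ↦ u ⬝ᵥ v := by
    unfold dotProduct; fun_prop
  constructor
  · intro hu v hv
    obtain ⟨m, hm⟩ := hv.1.exists_dotProduct_eq_one
    have hm' : incl n m ⬝ᵥ incl n v = 1 := by rw [incl_dotProduct_incl, hm, Int.cast_one]
    have hc : Continuous fun t : ℝ ↦ u + t • incl n m := by fun_prop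
    have hnhds : ∀ᶠ t : ℝ in nhds 0, u + t • incl n m ∈ Φ.diagonalSplittingPolytope := by
      apply hc.continuousAt.eventually
      simp only [zero_smul, add_zero]
      exact mem_interior_iff_mem_nhds.1 hu
    obtain ⟨ε, hε, hball⟩ := Metric.eventually_nhds_iff.1 hnhds
    have h1 := (hball (y := ε / 2) (by rw [dist_zero_right, Real.norm_eq_abs, abs_of_pos] <;> linarith)
      v hv).2
    have h2 := (hball (y := -(ε / 2)) (by
      rw [dist_zero_right, Real.norm_eq_abs, abs_neg, abs_of_pos] <;> linarith) v hv).1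
    rw [add_dotProduct, smul_dotProduct, hm', smul_eq_mul, mul_one] at h1 h2
    constructor <;> linarith
  · intro hu
    have hopen : IsOpen (⋂ v ∈ Φ.rayGenerators,
        {u : Fin n → ℝ | -1 < u ⬝ᵥ incl n v ∧ u ⬝ᵥ incl n v < 1}) :=
      Φ.finite_rayGenerators.isOpen_biInter fun v _ ↦
        (isOpen_lt continuous_const (hcont _)).inter (isOpen_lt (hcont _) continuous_const)
    refine interior_maximal ?_ hopen (Set.mem_iInter₂.2 hu)
    intro u hu v hv
    have := Set.mem_iInter₂.1 hu v hv
    exact ⟨this.1.le, this.2.le⟩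

end

/-! ### Laurent monomials on the square of the torus -/

section

variable {S A : Type*} [AddCommGroup A]

/-- The additive map from `ℤ[S]` with given values on the monomials. -/
def extendSingle (h : S → A) : AddMonoidAlgebra ℤ S →+ A :=
  (Finsupp.liftAddHom fun s ↦ zmultiplesHom A (h s)).comp
    AddMonoidAlgebra.coeffAddEquiv.toAddMonoidHom

lemma extendSingle_single (h : S → A) (s : S) (r : ℤ) :
    extendSingle h (.single s r) = r • h s := by
  change Finsupp.liftAddHom (fun s ↦ zmultiplesHom A (h s)) (Finsupp.single s r) = _
  simp

end

lemma exists_of_coeff_mapDomain_ne_zero {S T : Type*} {f : S → T} {x : AddMonoidAlgebra ℤ S}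
    {t : T} (h : (x.mapDomain f).coeff t ≠ 0) : ∃ s, f s = t ∧ x.coeff s ≠ 0 := by
  classical
  obtain ⟨s, hs, rfl⟩ := Finset.mem_image.1 (Finsupp.mapDomain_support (Finsupp.mem_support_iff.2 h))
  exact ⟨s, rfl, Finsupp.mem_support_iff.1 hs⟩

variable {n : ℕ}

lemma mem_dualMonoid_bot (u : Fin n → ℤ) : u ∈ dualMonoid (⊥ : PointedCone ℝ (Fin n → ℝ)) := by
  rintro v rfl
  rw [dotProduct_zero]

/-- A Laurent monomial on the torus. -/
def torusMonomial (u : Fin n → ℤ) :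
    AddMonoidAlgebra ℤ (dualMonoid (⊥ : PointedCone ℝ (Fin n → ℝ))) :=
  .single ⟨u, mem_dualMonoid_bot u⟩ 1

/-- A Laurent monomial on the square of the torus. -/
def squareMonomial (u w : Fin n → ℤ) :
    AddMonoidAlgebra ℤ (dualMonoid (⊥ : PointedCone ℝ (Fin n → ℝ)) ×
      dualMonoid (⊥ : PointedCone ℝ (Fin n → ℝ))) :=
  .single (⟨u, mem_dualMonoid_bot u⟩, ⟨w, mem_dualMonoid_bot w⟩) 1

lemma addRingHom_squareMonomial (u w : Fin n → ℤ) :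
    addRingHom _ (squareMonomial u w) = torusMonomial (u + w) :=
  addRingHom_single _ _ _

lemma powRingHom_squareMonomial (q : ℕ) (u w : Fin n → ℤ) :
    powRingHom _ q (squareMonomial u w) = squareMonomial (q • u) (q • w) :=
  powRingHom_single _ _ _

lemma squareMonomial_mul (u w u' w' : Fin n → ℤ) :
    squareMonomial u w * squareMonomial u' w' = squareMonomial (u + u') (w + w') := by
  rw [squareMonomial, squareMonomial, AddMonoidAlgebra.single_mul_single, one_mul]
  rfl

lemma coeff_squareMonomial_mul (m m' : Fin n → ℤ) (x) (w w' : Fin n → ℤ) :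
    (squareMonomial m m' * x).coeff
        (⟨w + m, mem_dualMonoid_bot _⟩, ⟨w' + m', mem_dualMonoid_bot _⟩) =
      x.coeff (⟨w, mem_dualMonoid_bot w⟩, ⟨w', mem_dualMonoid_bot w'⟩) := by
  rw [squareMonomial, AddMonoidAlgebra.coeff_single_mul_eq_mul_coeff
    (m₂ := (⟨w, mem_dualMonoid_bot w⟩, ⟨w', mem_dualMonoid_bot w'⟩)), one_mul]
  rintro ⟨a, b⟩ -
  simp only [Prod.mk_add_mk, Prod.mk.injEq, Subtype.ext_iff, AddSubmonoid.coe_add]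
  rw [add_comm m, add_comm m', add_left_inj, add_left_inj]

namespace Fan

variable (Φ : Fan n)

lemma prodRestriction_single_bot {h0 : ⊥ ∈ Φ.cones} {i : Φ.Index × Φ.Index}
    (h : ((⟨⊥, h0⟩, ⟨⊥, h0⟩) : Φ.Index × Φ.Index) ≤ i) {u w : Fin n → ℤ}
    (hu : u ∈ dualMonoid i.1.1) (hw : w ∈ dualMonoid i.2.1) :
    prodRestriction h (.single (⟨u, hu⟩, ⟨w, hw⟩) 1) = squareMonomial u w :=
  prodRestriction_single _ _ _ _ _

/-! ### Necessity: lattice points from a diagonal splitting -/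

/-- The exponents of the monomials of `p (x^(u, u'))`, for a semilinear map `p` that preserves the
functions on a chart. -/
lemma add_mem_dualMonoid_of_coeff_ne_zero {q : ℕ} {h0 : ⊥ ∈ Φ.cones} {p}
    (hp : IsSemilinear (powRingHom _ q) p) {i : Φ.Index × Φ.Index}
    (h : ((⟨⊥, h0⟩, ⟨⊥, h0⟩) : Φ.Index × Φ.Index) ≤ i)
    (hpi : ∀ s, ∃ t, prodRestriction h t = p (prodRestriction h s)) {u u' w w' m m' : Fin n → ℤ}
    (hne : (p (squareMonomial u u')).coeff
      (⟨w, mem_dualMonoid_bot w⟩, ⟨w', mem_dualMonoid_bot w'⟩) ≠ 0)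
    (hu : q • m + u ∈ dualMonoid i.1.1) (hu' : q • m' + u' ∈ dualMonoid i.2.1) :
    w + m ∈ dualMonoid i.1.1 ∧ w' + m' ∈ dualMonoid i.2.1 := by
  -- The monomial `x^(qm+u, qm'+u')` is a function on the chart, and `p` sends it to `x^(m,m')
  -- p(x^(u,u'))`, which is again one.
  obtain ⟨t, ht⟩ := hpi (.single (⟨_, hu⟩, ⟨_, hu'⟩) 1)
  rw [prodRestriction_single_bot, ← squareMonomial_mul, ← powRingHom_squareMonomial, hp] at ht
  rw [← coeff_squareMonomial_mul m m', ← ht] at hne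
  obtain ⟨⟨a, b⟩, hab, -⟩ := exists_of_coeff_mapDomain_ne_zero hne
  have h1 : (a : Fin n → ℤ) = w + m := congrArg (fun s ↦ (s.1 : Fin n → ℤ)) hab
  have h2 : (b : Fin n → ℤ) = w' + m' := congrArg (fun s ↦ (s.2 : Fin n → ℤ)) hab
  exact ⟨h1 ▸ a.2, h2 ▸ b.2⟩

lemma dotProduct_nonneg {σ : PointedCone ℝ (Fin n → ℝ)} {u v : Fin n → ℤ} (hu : u ∈ dualMonoid σ)
    (hv : incl n v ∈ σ) : 0 ≤ u ⬝ᵥ v := by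
  have := hu _ hv
  rw [incl_dotProduct_incl] at this
  exact_mod_cast this

lemma mem_dualMonoid_hull_singleton {u v : Fin n → ℤ} (h : 0 ≤ u ⬝ᵥ v) :
    u ∈ dualMonoid (PointedCone.hull ℝ {incl n v}) := by
  intro x hx
  obtain ⟨a, rfl⟩ := Submodule.mem_span_singleton.1 hx
  have : incl n u ⬝ᵥ (a • incl n v) = (a : ℝ) * (incl n u ⬝ᵥ incl n v) :=
    dotProduct_smul (a : ℝ) _ _
  rw [this, incl_dotProduct_incl]
  exact mul_nonneg a.2 (by exact_mod_cast h)

/-- The smallest admissible `k` is `-⌊x/q⌋`; it gives `y ≥ ⌊x/q⌋ > x/q - 1`. -/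
lemma neg_lt_mul_sub_of_forall {q : ℕ} (hq : 0 < q) {x y : ℤ}
    (h : ∀ k : ℤ, 0 ≤ q * k + x → 0 ≤ y + k) : -(q : ℤ) < q * y - x := by
  have hq' : (0 : ℤ) < q := by exact_mod_cast hq
  have h1 := Int.emod_add_mul_ediv x q
  have h2 := Int.emod_nonneg x hq'.ne'
  have h3 := Int.emod_lt_of_pos x hq'
  have h4 := h (-(x / q)) (by linarith)
  have h5 : (q : ℤ) * (x / q) ≤ q * y := by gcongr; linarith
  linarith

theorem exists_lattice_point_of_isDiagonallySplit {q : ℕ} (hq : 0 < q) (h0 : ⊥ ∈ Φ.cones)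
    (h : Φ.IsDiagonallySplit q) (u : Fin n → ℤ) :
    ∃ w : Fin n → ℤ, ∀ v ∈ Φ.rayGenerators, |q * (w ⬝ᵥ v) - u ⬝ᵥ v| < (q : ℤ) := by
  have ho (σ : Φ.Index) : (⟨⊥, h0⟩ : Φ.Index) ≤ σ := (bot_le : ⊥ ≤ σ.1)
  obtain ⟨p, hp, hp1, hpi, hpd⟩ := (Φ.isDiagonallySplit_iff hq.ne' ho).1 h
  obtain ⟨w, hw⟩ : ∃ w : Fin n → ℤ, (p (squareMonomial u (-u))).coeff
      (⟨w, mem_dualMonoid_bot w⟩, ⟨-w, mem_dualMonoid_bot _⟩) ≠ 0 := by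
    have h1 := hpd (squareMonomial u (-u) - 1) (by
      rw [map_sub, addRingHom_squareMonomial, add_neg_cancel, map_one, sub_eq_zero]
      rfl)
    rw [map_sub, hp1, map_sub, map_one, sub_eq_zero] at h1
    -- The constant term 1 on the diagonal is the sum of the coefficients at the exponents `(w,
    -- -w)`, so one of these is nonzero.
    have h2 : (addRingHom _ (p (squareMonomial u (-u)))).coeff 0 ≠ 0 := by
      rw [h1, AddMonoidAlgebra.coeff_one_zero]
      exact one_ne_zero
    obtain ⟨⟨a, b⟩, hab, hne⟩ := exists_of_coeff_mapDomain_ne_zero h2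
    have hab' : (a : Fin n → ℤ) + b = 0 := congrArg Subtype.val hab
    refine ⟨a, ?_⟩
    convert! hne using 3
    exact Subtype.ext (neg_eq_of_add_eq_zero_right hab')
  refine ⟨w, fun v hv ↦ ?_⟩
  obtain ⟨m, hm⟩ := hv.1.exists_dotProduct_eq_one
  let ρ : Φ.Index := ⟨_, hv.2⟩
  have hvρ : incl n v ∈ ρ.1 := PointedCone.subset_hull (Set.mem_singleton _)
  rw [abs_lt]
  constructor
  -- The chart `U_ρ × T` bounds `⟨w, v⟩` from below, and `T × U_ρ` bounds `⟨-w, v⟩`. Since `⟨m, v⟩ =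
  -- 1`, the shifts by `k • m` test every integer `k`.
  · refine neg_lt_mul_sub_of_forall hq fun k hk ↦ ?_
    have := (Φ.add_mem_dualMonoid_of_coeff_ne_zero hp (i := (ρ, ⟨⊥, h0⟩)) ⟨ho _, ho _⟩ (hpi _ _) hw
      (m := k • m) (m' := 0) (mem_dualMonoid_hull_singleton (by
        rw [add_dotProduct, smul_dotProduct, smul_dotProduct, hm]; simpa using hk))
      (mem_dualMonoid_bot _)).1
    have := dotProduct_nonneg this hvρ
    rwa [add_dotProduct, smul_dotProduct, hm, smul_eq_mul, mul_one] at this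
  · have : -(q : ℤ) < q * (-w ⬝ᵥ v) - (-u ⬝ᵥ v) := by
      refine neg_lt_mul_sub_of_forall hq fun k hk ↦ ?_
      have := (Φ.add_mem_dualMonoid_of_coeff_ne_zero hp (i := (⟨⊥, h0⟩, ρ)) ⟨ho _, ho _⟩ (hpi _ _) hw
        (m := 0) (m' := k • m) (mem_dualMonoid_bot _) (mem_dualMonoid_hull_singleton (by
          rw [add_dotProduct, smul_dotProduct, smul_dotProduct, hm]; simpa using hk))).2
      have := dotProduct_nonneg this hvρ
      rwa [add_dotProduct, smul_dotProduct, hm, smul_eq_mul, mul_one] at this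
    rw [neg_dotProduct, neg_dotProduct] at this
    linarith

end Fan

/-! ### Sufficiency: a diagonal splitting from lattice points -/

/-- Coordinatewise quotient of a lattice point by `q`. -/
def floorDiv (q : ℕ) (y : Fin n → ℤ) : Fin n → ℤ := fun i ↦ y i / q

lemma floorDiv_nsmul_add {q : ℕ} (hq : 0 < q) (m y : Fin n → ℤ) :
    floorDiv q (q • m + y) = m + floorDiv q y := by
  ext i
  have hq' : (q : ℤ) ≠ 0 := by exact_mod_cast hq.ne'
  have h : (q • m + y) i = q * m i + y i := by simp
  rw [Pi.add_apply, floorDiv, floorDiv, h, add_comm, Int.add_mul_ediv_left _ _ hq', add_comm]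

lemma floorDiv_zero (q : ℕ) : floorDiv q (0 : Fin n → ℤ) = 0 := by
  ext i
  simp [floorDiv]

/-- Approximate division by `q` along the rays can be chosen periodically. -/
lemma exists_periodic {q : ℕ} (hq : 0 < q) {R : Set (Fin n → ℤ)}
    (h : ∀ u : Fin n → ℤ, ∃ w : Fin n → ℤ, ∀ v ∈ R, |q * (w ⬝ᵥ v) - u ⬝ᵥ v| < (q : ℤ)) :
    ∃ e : (Fin n → ℤ) → (Fin n → ℤ), e 0 = 0 ∧ (∀ m u, e (q • m + u) = m + e u) ∧
      ∀ u, ∀ v ∈ R, |q * (e u ⬝ᵥ v) - u ⬝ᵥ v| < (q : ℤ) := by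
  classical
  choose f hf using h
  -- The choice is made only on the representatives `r u` modulo `qM` and extended by translation;
  -- at 0 it is replaced by 0, which makes `p 1 = 1`.
  let r (u : Fin n → ℤ) : Fin n → ℤ := u - q • floorDiv q u
  let g (u : Fin n → ℤ) : Fin n → ℤ := if u = 0 then 0 else f u
  have hg (u) (v) (hv : v ∈ R) : |q * (g u ⬝ᵥ v) - u ⬝ᵥ v| < (q : ℤ) := by
    by_cases hu : u = 0
    · simp [g, hu, hq]
    · simp only [g, if_neg hu]
      exact hf u v hv
  refine ⟨fun u ↦ g (r u) + floorDiv q u, ?_, fun m u ↦ ?_, fun u v hv ↦ ?_⟩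
  · simp [g, r, floorDiv_zero]
  · have : r (q • m + u) = r u := by
      simp only [r, floorDiv_nsmul_add hq, smul_add]
      abel
    dsimp only
    rw [this, floorDiv_nsmul_add hq]
    abel
  · have := hg (r u) v hv
    have h1 : r u ⬝ᵥ v = u ⬝ᵥ v - q * (floorDiv q u ⬝ᵥ v) := by
      simp only [r]
      rw [sub_dotProduct, smul_dotProduct, nsmul_eq_mul]
    rw [h1] at this
    rw [add_dotProduct]
    convert! this using 2
    ring

/-- A map from `ℤ[S]` is semilinear if it is so on monomials. -/
lemma isSemilinear_extendSingle {S : Type} [AddCommMonoid S] (q : ℕ)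
    (h : S → AddMonoidAlgebra ℤ S) (hh : ∀ s t, h (q • s + t) = .single s 1 * h t) :
    IsSemilinear (powRingHom S q) (extendSingle h) := by
  intro a b
  induction a using AddMonoidAlgebra.induction_linear with
  | zero => simp
  | add a a' ha ha' => rw [map_add, add_mul, map_add, ha, ha', add_mul]
  | single s r =>
    induction b using AddMonoidAlgebra.induction_linear with
    | zero => simp
    | add b b' hb hb' => rw [mul_add, map_add, hb, hb', map_add, mul_add]
    | single t r' =>
      rw [powRingHom_single, AddMonoidAlgebra.single_mul_single, extendSingle_single,
        extendSingle_single, hh, mul_smul_comm, mul_comm r, mul_smul, ← smul_mul_assoc,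
        AddMonoidAlgebra.smul_single, smul_eq_mul, mul_one]

namespace Fan

variable (Φ : Fan n)

/-- The values on the monomials of the splitting of the square of the torus given by `e`. -/
def splitMonomial (q : ℕ) (e : (Fin n → ℤ) → (Fin n → ℤ))
    (s : dualMonoid (⊥ : PointedCone ℝ (Fin n → ℝ)) × dualMonoid (⊥ : PointedCone ℝ (Fin n → ℝ))) :
    AddMonoidAlgebra ℤ (dualMonoid (⊥ : PointedCone ℝ (Fin n → ℝ)) ×
      dualMonoid (⊥ : PointedCone ℝ (Fin n → ℝ))) :=
  if q • floorDiv q (s.1 + s.2 : Fin n → ℤ) = s.1 + s.2 then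
    squareMonomial (e s.1) (floorDiv q (s.1 + s.2 : Fin n → ℤ) - e s.1) else 0

lemma splitMonomial_nsmul_add {q : ℕ} (hq : 0 < q) {e : (Fin n → ℤ) → (Fin n → ℤ)}
    (he : ∀ m u, e (q • m + u) = m + e u) (s t) :
    splitMonomial q e (q • s + t) = .single s 1 * splitMonomial q e t := by
  have h1 : ((q • s + t).1 + (q • s + t).2 : Fin n → ℤ) =
      q • (s.1 + s.2 : Fin n → ℤ) + (t.1 + t.2) := by
    change (q • (s.1 : Fin n → ℤ) + t.1) + (q • (s.2 : Fin n → ℤ) + t.2) = _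
    rw [smul_add]
    abel
  have h2 : (((q • s + t).1 : dualMonoid ⊥) : Fin n → ℤ) = q • (s.1 : Fin n → ℤ) + t.1 := rfl
  have h3 : (.single s 1 : AddMonoidAlgebra ℤ _) = squareMonomial s.1 s.2 := rfl
  simp only [splitMonomial, h1, floorDiv_nsmul_add hq]
  simp only [h2, h3, he, smul_add, add_assoc, add_right_inj]
  split_ifs
  · rw [squareMonomial_mul]
    congr 1
    abel
  · rw [mul_zero]

/-- The two exponents produced by `splitMonomial` sum to `(u + w)/q`, so on the diagonal the result
depends only on `u + w`. The test `q • floorDiv q y = y` expresses that `y` lies in `qM`. -/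
lemma addRingHom_extendSingle_splitMonomial (q : ℕ) (e : (Fin n → ℤ) → (Fin n → ℤ)) (s) :
    addRingHom _ (extendSingle (splitMonomial q e) s) = extendSingle
      (fun y : dualMonoid (⊥ : PointedCone ℝ (Fin n → ℝ)) ↦
        if q • floorDiv q (y : Fin n → ℤ) = y then torusMonomial (floorDiv q y) else 0)
      (addRingHom _ s) := by
  induction s using AddMonoidAlgebra.induction_linear with
  | zero => simp
  | add a b ha hb => rw [map_add, map_add, map_add, map_add, ha, hb]
  | single s r =>
    obtain ⟨a, b⟩ := s
    rw [addRingHom_single, extendSingle_single, extendSingle_single, map_zsmul, splitMonomial]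
    simp only [AddSubmonoid.coe_add]
    split_ifs
    · rw [addRingHom_squareMonomial, add_sub_cancel]
    · rw [map_zero]

variable {Φ} in
-- On a ray of `σ`, `q⟨w, v⟩ > ⟨u, v⟩ - q ≥ -q` forces the integer `⟨w, v⟩` to be nonnegative.
lemma mem_dualMonoid_of_lt {σ : PointedCone ℝ (Fin n → ℝ)} (hσ : σ ∈ Φ.cones) {q : ℕ}
    {u w : Fin n → ℤ} (hu : u ∈ dualMonoid σ)
    (h : ∀ v ∈ Φ.rayGenerators, -(q : ℤ) < q * (w ⬝ᵥ v) - u ⬝ᵥ v) : w ∈ dualMonoid σ := by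
  refine Φ.mem_dualMonoid_of_rays hσ fun v hv hvσ ↦ ?_
  have h1 := h v hv
  have h2 := dotProduct_nonneg hu hvσ
  by_contra! h3
  have h4 : (q : ℤ) * (w ⬝ᵥ v) ≤ q * (-1) := by gcongr; omega
  linarith

theorem isDiagonallySplit_of_exists_lattice_point {q : ℕ} (hq : 0 < q) (h0 : ⊥ ∈ Φ.cones)
    (h : ∀ u : Fin n → ℤ, ∃ w : Fin n → ℤ, ∀ v ∈ Φ.rayGenerators,
      |q * (w ⬝ᵥ v) - u ⬝ᵥ v| < (q : ℤ)) : Φ.IsDiagonallySplit q := by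
  obtain ⟨e, he0, he, hev⟩ := exists_periodic hq h
  have ho (σ : Φ.Index) : (⟨⊥, h0⟩ : Φ.Index) ≤ σ := (bot_le : ⊥ ≤ σ.1)
  refine (Φ.isDiagonallySplit_iff hq.ne' ho).2 ⟨extendSingle (splitMonomial q e),
    isSemilinear_extendSingle q _ (splitMonomial_nsmul_add hq he), ?_, fun i hi s ↦ ?_,
    fun s hs ↦ ?_⟩
  · rw [AddMonoidAlgebra.one_def, extendSingle_single, one_smul, splitMonomial]
    simp only [Prod.fst_zero, Prod.snd_zero, AddSubmonoid.coe_zero, add_zero, floorDiv_zero,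
      smul_zero, if_true, he0, sub_zero]
    rfl
  · induction s using AddMonoidAlgebra.induction_linear with
    | zero => exact ⟨0, by simp⟩
    | add a b ha hb =>
      obtain ⟨t, ht⟩ := ha
      obtain ⟨t', ht'⟩ := hb
      exact ⟨t + t', by rw [map_add, map_add, map_add, ht, ht']⟩
    | single s r =>
      obtain ⟨⟨u, hu⟩, ⟨w, hw⟩⟩ := s
      rw [prodRestriction_single, extendSingle_single, splitMonomial]
      dsimp only
      split_ifs with hz
      · have h1 : e u ∈ dualMonoid i.1.1 :=
          mem_dualMonoid_of_lt i.1.2 hu fun v hv ↦ (abs_lt.1 (hev u v hv)).1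
        -- Here `q((u+w)/q - e u) - w = u - q e(u)`, so the upper bound for `e` on the first factor
        -- is the lower bound on the second.
        have h2 : floorDiv q (u + w) - e u ∈ dualMonoid i.2.1 := by
          refine mem_dualMonoid_of_lt (q := q) i.2.2 hw fun v hv ↦ ?_
          have h3 := (abs_lt.1 (hev u v hv)).2
          have h4 := congrArg (· ⬝ᵥ v) hz
          rw [smul_dotProduct, add_dotProduct, nsmul_eq_mul] at h4
          rw [sub_dotProduct, mul_sub, h4]
          linarith
        exact ⟨r • .single (⟨_, h1⟩, ⟨_, h2⟩) 1, by
          rw [map_zsmul, prodRestriction_single_bot]⟩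
      · exact ⟨0, by simp⟩
  · rw [addRingHom_extendSingle_splitMonomial, hs, map_zero]

end Fan

/-! ### Classes of fractional lattice points -/

/-- Representatives of the classes of `(1/q)M / M` in the interior of the polytope, in terms of
lattice points. -/
lemma Fan.forall_exists_representative_iff (Φ : Fan n) {q : ℕ} (hq : 0 < q) :
    (∀ c : fractionalM n q ⧸ (latticeM n).addSubgroupOf (fractionalM n q),
      ∃ a : fractionalM n q, (a : Fin n → ℝ) ∈ interior Φ.diagonalSplittingPolytope ∧
        QuotientAddGroup.mk a = c) ↔
    ∀ u : Fin n → ℤ, ∃ w : Fin n → ℤ, ∀ v ∈ Φ.rayGenerators,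
      |q * (w ⬝ᵥ v) - u ⬝ᵥ v| < (q : ℤ) := by
  have hq' : (0 : ℝ) < q := by exact_mod_cast hq
  have key {a : Fin n → ℝ} {u w v : Fin n → ℤ} (ha : q • a = incl n (q • w - u)) :
      |q * (w ⬝ᵥ v) - u ⬝ᵥ v| < (q : ℤ) ↔ -1 < a ⬝ᵥ incl n v ∧ a ⬝ᵥ incl n v < 1 := by
    have h1 := congrArg (· ⬝ᵥ incl n v) ha
    rw [incl_dotProduct_incl, smul_dotProduct, sub_dotProduct, smul_dotProduct, nsmul_eq_mul,
      nsmul_eq_mul] at h1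
    have h2 : |q * (w ⬝ᵥ v) - u ⬝ᵥ v| < (q : ℤ) ↔
        |((q * (w ⬝ᵥ v) - u ⬝ᵥ v : ℤ) : ℝ)| < (q : ℝ) := by
      exact_mod_cast Iff.rfl
    rw [h2, ← h1, abs_mul, abs_of_pos hq', ← abs_lt, mul_lt_iff_lt_one_right hq']
  constructor
  · intro h u
    -- The representatives of the class of `-u/q` are the points `w - u/q`.
    have hmem : (q : ℝ)⁻¹ • incl n (-u) ∈ fractionalM n q := by
      refine ⟨-u, ?_⟩
      change _ = q • ((q : ℝ)⁻¹ • incl n (-u))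
      rw [← Nat.cast_smul_eq_nsmul ℝ, smul_smul, mul_inv_cancel₀ hq'.ne', one_smul]
    obtain ⟨a, ha, hc⟩ := h (QuotientAddGroup.mk ⟨_, hmem⟩)
    obtain ⟨w, hw⟩ := AddSubgroup.mem_addSubgroupOf.1 (QuotientAddGroup.eq.1 hc.symm)
    refine ⟨w, fun v hv ↦ (key ?_).2 (Φ.mem_interior_diagonalSplittingPolytope.1 ha v hv)⟩
    have hw' : incl n w = -((q : ℝ)⁻¹ • incl n (-u)) + a := hw
    have ha' : (a : Fin n → ℝ) = incl n w + (q : ℝ)⁻¹ • incl n (-u) := by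
      rw [hw']; abel
    rw [ha', smul_add, ← Nat.cast_smul_eq_nsmul ℝ q ((q : ℝ)⁻¹ • incl n (-u)), smul_smul,
      mul_inv_cancel₀ hq'.ne', one_smul, map_sub, map_nsmul, map_neg, sub_eq_add_neg]
  · intro h c
    obtain ⟨⟨a, b, hb⟩, rfl⟩ := QuotientAddGroup.mk_surjective c
    obtain ⟨w, hw⟩ := h (-b)
    replace hb : incl n b = q • a := hb
    have hmem : incl n w ∈ fractionalM n q := ⟨q • w, map_nsmul _ _ _⟩
    refine ⟨⟨a, b, hb⟩ + ⟨incl n w, hmem⟩, ?_, ?_⟩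
    · refine Φ.mem_interior_diagonalSplittingPolytope.2 fun v hv ↦ (key ?_).1 (hw v hv)
      change q • (a + incl n w) = _
      rw [smul_add, ← hb, sub_neg_eq_add, map_add, map_nsmul, add_comm]
    · refine (QuotientAddGroup.eq.2 (AddSubgroup.mem_addSubgroupOf.2 ?_)).symm
      rw [neg_add_cancel_left]
      exact ⟨w, rfl⟩

end Toric

end

theorem theorem1 (n : ℕ) (Φ : Toric.Fan n) (hΦ : Φ.IsComplete) (q : ℕ) (hq : 2 ≤ q) :
    Φ.IsDiagonallySplit q ↔
      ∀ c : Toric.fractionalM n q ⧸ (Toric.latticeM n).addSubgroupOf (Toric.fractionalM n q),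
        ∃ a : Toric.fractionalM n q,
          (a : Fin n → ℝ) ∈ interior Φ.diagonalSplittingPolytope ∧ QuotientAddGroup.mk a = c := by
  have hq0 : 0 < q := by omega
  -- Completeness provides a cone, hence its zero face, whose chart is the torus.
  obtain ⟨σ, hσ, -⟩ := hΦ 0
  rw [Φ.forall_exists_representative_iff hq0]
  exact ⟨Φ.exists_lattice_point_of_isDiagonallySplit hq0 (Φ.bot_mem hσ),
    Φ.isDiagonallySplit_of_exists_lattice_point hq0 (Φ.bot_mem hσ)⟩
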